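/- **Setting.** Fix a first-order vocabulary (of any cardinality, with identity) and a countable set $\Theta$ of first-order formulas $\theta(\overline{x},\overline{y})$, each given with a splitting of its free variables into a non-empty finite list $\overline{x}$ (its length is the *arity* of $\theta$) and a finite, possibly empty, list $\overline{y}$ of parameters. For a structure $\mathfrak{A}$ with non-empty domain $A$, let $K_\Theta^A$ be the collection of all relations $\{\overline{d}\mid \mathfrak{A}\models\theta[\overline{d},\overline{e}]\}$ with $\theta(\overline{x},\overline{y})\in\Theta$ and $\overline{e}$ a sequence of elements of $A$; $(\mathfrak{A},K_\Theta^A)$ is called a *standard structure*. The formulas of $\mathcal{L}^2_\Theta$ are built by $\neg$, $\wedge$, $\forall x$ and $\forall V$ from first-order atomic formulas, atomic formulas $V^k_m(t_1,\dots,t_k)$, and equations $V^k_m=V^k_n$, with countably many individual variables and, for each arity $k$ of a member of $\Theta$, countably many relation variables $V^k_0,V^k_1,\dots$; other connectives are abbreviations. In a standard structure the variables $V^k_m$ range over the $k$-ary members of $K_\Theta^A$. Write $\Sigma\models\varphi$ if every standard structure in which all members of $\Sigma$ hold is one in which $\varphi$ holds. For $\theta(\overline{x},\overline{y})\in\Theta$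 of arity $k$, let $\varphi^{k,m}_{\theta}$ be the formula obtained from $\varphi$ by replacing every free occurrence $V^k_m(\overline{t})$ by $\theta(\overline{t},\overline{y})$, where $\overline{y}$ are variables that do not occur in $\varphi$ and the bound variables of $\theta$ are renamed to avoid capture, and by prefixing the result with $\forall\overline{y}$; here an equation $V^k_i=V^k_j$ with $V^k_m$ occurring free as one of its sides is first written as $\forall\overline{x}(V^k_i(\overline{x})\leftrightarrow V^k_j(\overline{x}))$. **Formal system.** The axioms are those of a complete Hilbert system for first-order logic with identity (propositional tautologies; $\forall x\varphi\to\varphi(x/t)$ with $t$ free for $x$ in $\varphi$; $\forall x(\varphi\to\psi)\to(\varphi\to\forall x\psi)$ with $x$ not free in $\varphi$; $t=t$; $s=t\to(\varphi(x/s)\to\varphi(x/t))$ with $s,t$ free for $x$ in $\varphi$), as schemata for all formulas of $\mathcal{L}^2_\Theta$, together with: - (A1) $\forall\overline{y}\,\exists V\,\forall\overline{x}\,(V(\overline{x})\leftrightarrow\theta(\overline{x},\overline{y}))$ for each $\theta(\overline{x},\overline{y})\in\Theta$; - (A2) $\forall V_m\forall V_n(\forall\overline{x}(V_m(\overline{x})\leftrightarrow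 V_n(\overline{x}))\leftrightarrow V_m=V_n)$, for $V_m,V_n$ of the same arity; - (A3) $\forall V_m\forall V_n(V_m=V_n\to(\varphi\to\varphi'))$, where $V_m,V_n$ have the same arity and $\varphi'$ results from $\varphi$ by replacing some free occurrences of $V_m$ by free occurrences of $V_n$; - (A4) $\forall V_m\varphi\to\varphi(V_m/V_n)$, where $V_m,V_n$ have the same arity and $V_n$ is free for $V_m$ in $\varphi$; - (A5) $\forall V_m(\varphi\to\psi)\to(\varphi\to\forall V_m\psi)$, where $V_m$ is not free in $\varphi$; - (A6) $\forall V^k_m\varphi\to\varphi^{k,m}_{\theta}$ for each $\theta\in\Theta$ of arity $k$. The rules are (R1) modus ponens; (R2) generalization, from $\varphi$ infer $\forall x\varphi$ and infer $\forall V\varphi$; (R3) from the formulas $\psi\to\varphi^{k,m}_{\theta}$ for all $\theta\in\Theta$ of arity $k$, infer $\psi\to\forall V^k_m\varphi$. A deduction of $\varphi$ from $\Sigma$ is a countable well-ordered (possibly transfinite) sequence of formulas with last member $\varphi$, each member of which is in $\Sigma$, is an axiom, or comes from previous members by one of (R1)–(R3). Write $\Sigma\vdash\varphi$ if there is one. **Theorem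 (Strong Completeness).** Let $\Sigma$ be a countable set of $\mathcal{L}^2_\Theta$-sentences and let $\varphi$ be an $\mathcal{L}^2_\Theta$-sentence (no free variables of either sort). If $\Sigma\models\varphi$, then $\Sigma\vdash\varphi$. -/

import Mathlib

universe u v w

namespace RestrictedSO

open FirstOrder.Language

/-- A first-order formula `θ(x̄, ȳ)` with its free variables split into the list `x̄` of length
`l + 1` (the arity of the relation that it defines) and a finite list `ȳ` of parameter variables. -/
structure Scheme (L : FirstOrder.Language.{u, v}) (l : ℕ) where
  params : ℕ
  formula : L.Formula (Fin (l + 1) ⊕ Fin params)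

/-- A set `Θ` of first-order formulas `θ(x̄, ȳ)`, sorted by arity:
`Θ l` is the set of the members of `Θ` that define relations of arity `l + 1`. -/
abbrev Family (L : FirstOrder.Language.{u, v}) := (l : ℕ) → Set (Scheme L l)

variable {L : FirstOrder.Language.{u, v}}

/-- The numbers `l` for which relations of arity `l + 1` are defined by members of `Θ`. -/
abbrev Ar (Θ : Family L) := {l : ℕ // (Θ l).Nonempty}

/-- The formulas of the second-order language `L²_Θ`. The first-order variables are `x₀, x₁, …`;
for each arity `l + 1` occurring in `Θ` there are relation variables `V^{l+1}_0, V^{l+1}_1, …`,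
and `V^{l+1}_m` is referred to by the pair `l`, `m`. -/
inductive Fml (Θ : Family L) : Type max u v
  | eq (s t : L.Term ℕ) : Fml Θ
  | rel {n : ℕ} (R : L.Relations n) (ts : Fin n → L.Term ℕ) : Fml Θ
  | soEq (l : Ar Θ) (m n : ℕ) : Fml Θ
  | soApp (l : Ar Θ) (m : ℕ) (ts : Fin (l.1 + 1) → L.Term ℕ) : Fml Θ
  | neg (φ : Fml Θ) : Fml Θ
  | and (φ ψ : Fml Θ) : Fml Θ
  | all (x : ℕ) (φ : Fml Θ) : Fml Θ
  | soAll (l : Ar Θ) (m : ℕ) (φ : Fml Θ) : Fml Θ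

namespace Fml

variable {Θ : Family L}

/-! ### Defined connectives and quantifiers -/

def imp (φ ψ : Fml Θ) : Fml Θ := neg (and φ (neg ψ))

def iff (φ ψ : Fml Θ) : Fml Θ := and (imp φ ψ) (imp ψ φ)

def soEx (l : Ar Θ) (m : ℕ) (φ : Fml Θ) : Fml Θ := neg (soAll l m (neg φ))

def bot : Fml Θ := neg (all 0 (eq (Term.var 0) (Term.var 0)))

/-- `∀ x_s ∀ x_{s+1} … ∀ x_{s+n-1} φ`. -/
def allBlock : (s n : ℕ) → Fml Θ → Fml Θ
  | _, 0, φ => φ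
  | s, n + 1, φ => all s (allBlock (s + 1) n φ)

/-! ### Free variables -/

/-- The first-order variable `x` occurs free. -/
def FreeIn (x : ℕ) : Fml Θ → Prop
  | eq s t => x ∈ s.varFinset ∨ x ∈ t.varFinset
  | rel _ ts => ∃ i, x ∈ (ts i).varFinset
  | soEq _ _ _ => False
  | soApp _ _ ts => ∃ i, x ∈ (ts i).varFinset
  | neg φ => FreeIn x φ
  | and φ ψ => FreeIn x φ ∨ FreeIn x ψ
  | all y φ => x ≠ y ∧ FreeIn x φ
  | soAll _ _ φ => FreeIn x φ

/-- The second-order variable `V^{l+1}_m` occurs free. -/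
def SOFreeIn (l : Ar Θ) (m : ℕ) : Fml Θ → Prop
  | eq _ _ => False
  | rel _ _ => False
  | soEq l' i j => l' = l ∧ (i = m ∨ j = m)
  | soApp l' i _ => l' = l ∧ i = m
  | neg φ => SOFreeIn l m φ
  | and φ ψ => SOFreeIn l m φ ∨ SOFreeIn l m ψ
  | all _ φ => SOFreeIn l m φ
  | soAll l' i φ => ¬ (l' = l ∧ i = m) ∧ SOFreeIn l m φ

/-- A sentence: no free variables of either sort. -/
def IsSentence (φ : Fml Θ) : Prop :=
  (∀ x, ¬ FreeIn x φ) ∧ ∀ l m, ¬ SOFreeIn l m φ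

/-- A strict upper bound for the indices of all first-order variables, free or bound, in `φ`. -/
def varBound : Fml Θ → ℕ
  | eq s t => max (s.varFinset.sup (· + 1)) (t.varFinset.sup (· + 1))
  | rel _ ts => Finset.univ.sup fun i => (ts i).varFinset.sup (· + 1)
  | soEq _ _ _ => 0
  | soApp _ _ ts => Finset.univ.sup fun i => (ts i).varFinset.sup (· + 1)
  | neg φ => varBound φ
  | and φ ψ => max (varBound φ) (varBound ψ)
  | all y φ => max (y + 1) (varBound φ)
  | soAll _ _ φ => varBound φ

/-! ### Substitution of terms for first-order variables -/

/-- `φ(x/t)`: replace every free occurrence of `x` by the term `t`. -/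
def subst (x : ℕ) (t : L.Term ℕ) : Fml Θ → Fml Θ
  | eq s r => eq (s.subst (Function.update Term.var x t)) (r.subst (Function.update Term.var x t))
  | rel R ts => rel R fun i => (ts i).subst (Function.update Term.var x t)
  | soEq l m n => soEq l m n
  | soApp l m ts => soApp l m fun i => (ts i).subst (Function.update Term.var x t)
  | neg φ => neg (subst x t φ)
  | and φ ψ => and (subst x t φ) (subst x t ψ)
  | all y φ => if y = x then all y φ else all y (subst x t φ)
  | soAll l m φ => soAll l m (subst x t φ)

/-- The term `t` is free for `x` in the formula. -/
def FreeFor (x : ℕ) (t : L.Term ℕ) : Fml Θ → Prop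
  | eq _ _ => True
  | rel _ _ => True
  | soEq _ _ _ => True
  | soApp _ _ _ => True
  | neg φ => FreeFor x t φ
  | and φ ψ => FreeFor x t φ ∧ FreeFor x t ψ
  | all y φ => (x ≠ y ∧ FreeIn x φ) → (y ∉ t.varFinset ∧ FreeFor x t φ)
  | soAll _ _ φ => FreeFor x t φ

/-! ### Substitution of second-order variables for second-order variables -/

/-- `φ(V_m/V_n)`: replace every free occurrence of `V^{l+1}_m` by `V^{l+1}_n`. -/
def soSubst (l : Ar Θ) (m n : ℕ) : Fml Θ → Fml Θ
  | eq s t => eq s t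
  | rel R ts => rel R ts
  | soEq l' i j => if l' = l then soEq l' (if i = m then n else i) (if j = m then n else j)
      else soEq l' i j
  | soApp l' i ts => soApp l' (if l' = l ∧ i = m then n else i) ts
  | neg φ => neg (soSubst l m n φ)
  | and φ ψ => and (soSubst l m n φ) (soSubst l m n ψ)
  | all x φ => all x (soSubst l m n φ)
  | soAll l' i φ => if l' = l ∧ i = m then soAll l' i φ else soAll l' i (soSubst l m n φ)

/-- The variable `V^{l+1}_n` is free for `V^{l+1}_m` in the formula. -/
def SOFreeFor (l : Ar Θ) (m n : ℕ) : Fml Θ → Prop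
  | eq _ _ => True
  | rel _ _ => True
  | soEq _ _ _ => True
  | soApp _ _ _ => True
  | neg φ => SOFreeFor l m n φ
  | and φ ψ => SOFreeFor l m n φ ∧ SOFreeFor l m n ψ
  | all _ φ => SOFreeFor l m n φ
  | soAll l' i φ => (¬ (l' = l ∧ i = m) ∧ SOFreeIn l m φ) →
      (¬ (l' = l ∧ i = n) ∧ SOFreeFor l m n φ)

/-- `SORepl l m n φ φ'`: the formula `φ'` results from `φ` by replacing some (possibly none, possibly
all) of the free occurrences of `V^{l+1}_m` by free occurrences of `V^{l+1}_n`. -/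
inductive SORepl (l : Ar Θ) (m n : ℕ) : Fml Θ → Fml Θ → Prop
  | refl (φ : Fml Θ) : SORepl l m n φ φ
  | soEq (i j i' j' : ℕ) (hi : i' = i ∨ (i = m ∧ i' = n)) (hj : j' = j ∨ (j = m ∧ j' = n)) :
      SORepl l m n (soEq l i j) (soEq l i' j')
  | soApp (ts : Fin (l.1 + 1) → L.Term ℕ) : SORepl l m n (soApp l m ts) (soApp l n ts)
  | neg {φ φ' : Fml Θ} : SORepl l m n φ φ' → SORepl l m n (neg φ) (neg φ')
  | and {φ φ' ψ ψ' : Fml Θ} : SORepl l m n φ φ' → SORepl l m n ψ ψ' →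
      SORepl l m n (and φ ψ) (and φ' ψ')
  | all (x : ℕ) {φ φ' : Fml Θ} : SORepl l m n φ φ' → SORepl l m n (all x φ) (all x φ')
  | soAll (l' : Ar Θ) (i : ℕ) {φ φ' : Fml Θ} : ¬ (l' = l ∧ i = m) → ¬ (l' = l ∧ i = n) →
      SORepl l m n φ φ' → SORepl l m n (soAll l' i φ) (soAll l' i φ')

/-! ### Substitution of members of `Θ` for second-order variables -/

/-- Write a first-order formula in the language `L²_Θ`, with the terms `σ` put in for its free
variables and with `x_b, x_{b+1}, …` as its bound variables. No variable is captured when the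
variables of the terms `σ` have indices below `b`. -/
def ofFO {α : Type} (b : ℕ) (σ : α → L.Term ℕ) : {n : ℕ} → L.BoundedFormula α n → Fml Θ
  | _, .falsum => bot
  | _, .equal s t =>
      eq (s.subst (Sum.elim σ fun i => Term.var (b + i.1)))
        (t.subst (Sum.elim σ fun i => Term.var (b + i.1)))
  | _, .rel R ts => rel R fun i => (ts i).subst (Sum.elim σ fun i => Term.var (b + i.1))
  | _, .imp φ ψ => imp (ofFO b σ φ) (ofFO b σ ψ)
  | n, .all φ => all (b + n) (ofFO b σ φ)

/-- `θ(ts, ȳ)` with `ȳ` the variables `x_s, x_{s+1}, …` and with bound variables from `x_b` on. -/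
def ofScheme {l : ℕ} (θ : Scheme L l) (ts : Fin (l + 1) → L.Term ℕ) (s b : ℕ) : Fml Θ :=
  ofFO b (Sum.elim ts fun j : Fin θ.params => Term.var (s + j.1)) θ.formula

/-- The result of putting `θ(·, ȳ)` for `V^{l+1}_m` in the atomic formula `V^{l'+1}_i(ts)`, where `ȳ`
are the variables from `x_N` on; bound variables of `θ` are taken beyond `ȳ` and a further block of
`l + 1` variables. -/
def schemeAtom (l : Ar Θ) (m : ℕ) (θ : Scheme L l.1) (N : ℕ) (l' : Ar Θ) (i : ℕ)
    (ts : Fin (l'.1 + 1) → L.Term ℕ) : Fml Θ :=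
  if h : l' = l ∧ i = m then
    ofScheme θ (fun j => ts (Fin.cast (by rw [h.1]) j)) N (N + θ.params + (l.1 + 1))
  else soApp l' i ts

/-- Replace every free occurrence of `V^{l+1}_m` by `θ(·, ȳ)`, where `ȳ` are the variables from `x_N`
on. An equation `V_i = V_j` in which `V^{l+1}_m` is one of the sides has the meaning
`∀ x̄ (V_i(x̄) ↔ V_j(x̄))`, and the replacement is made there. -/
def schemeSubst (l : Ar Θ) (m : ℕ) (θ : Scheme L l.1) (N : ℕ) : Fml Θ → Fml Θ
  | eq s t => eq s t
  | rel R ts => rel R ts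
  | soEq l' i j =>
      if l' = l ∧ (i = m ∨ j = m) then
        allBlock (N + θ.params) (l'.1 + 1)
          (iff (schemeAtom l m θ N l' i fun r => Term.var (N + θ.params + r.1))
            (schemeAtom l m θ N l' j fun r => Term.var (N + θ.params + r.1)))
      else soEq l' i j
  | soApp l' i ts => schemeAtom l m θ N l' i ts
  | neg φ => neg (schemeSubst l m θ N φ)
  | and φ ψ => and (schemeSubst l m θ N φ) (schemeSubst l m θ N ψ)
  | all x φ => all x (schemeSubst l m θ N φ)
  | soAll l' i φ => if l' = l ∧ i = m then soAll l' i φ else soAll l' i (schemeSubst l m θ N φ)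

/-- The formula `∀ ȳ φ(V_m/θ(·, ȳ))`, with `ȳ` and the bound variables of `θ` not occurring
in `φ`. -/
def schemeInst (l : Ar Θ) (m : ℕ) (θ : Scheme L l.1) (φ : Fml Θ) : Fml Θ :=
  allBlock φ.varBound θ.params (schemeSubst l m θ φ.varBound φ)

/-! ### The formal system -/

/-- Propositional tautologies. -/
def IsTautology (φ : Fml Θ) : Prop :=
  ∀ val : Fml Θ → Prop, (∀ ψ, val (neg ψ) ↔ ¬ val ψ) →
    (∀ ψ χ, val (and ψ χ) ↔ val ψ ∧ val χ) → val φ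

/-- The logical axioms. The first five clauses, with modus ponens and generalization, are a complete
system for first-order logic with equality; the others are comprehension, extensionality, Leibniz's
law and the three principles for second-order quantifiers. -/
inductive Ax : Fml Θ → Prop
  | tautology (φ : Fml Θ) : IsTautology φ → Ax φ
  | allElim (x : ℕ) (t : L.Term ℕ) (φ : Fml Θ) : FreeFor x t φ → Ax (imp (all x φ) (subst x t φ))
  | allImp (x : ℕ) (φ ψ : Fml Θ) : ¬ FreeIn x φ → Ax (imp (all x (imp φ ψ)) (imp φ (all x ψ)))
  | eqRefl (t : L.Term ℕ) : Ax (eq t t)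
  | eqSubst (x : ℕ) (s t : L.Term ℕ) (φ : Fml Θ) : FreeFor x s φ → FreeFor x t φ →
      Ax (imp (eq s t) (imp (subst x s φ) (subst x t φ)))
  | comprehension (l : Ar Θ) (m : ℕ) (θ : Scheme L l.1) : θ ∈ Θ l.1 →
      Ax (allBlock (l.1 + 1) θ.params (soEx l m (allBlock 0 (l.1 + 1)
        (iff (soApp l m fun i => Term.var i.1)
          (ofScheme θ (fun i => Term.var i.1) (l.1 + 1) (l.1 + 1 + θ.params))))))
  | extensionality (l : Ar Θ) (m n : ℕ) :
      Ax (soAll l m (soAll l n (iff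
        (allBlock 0 (l.1 + 1)
          (iff (soApp l m fun i => Term.var i.1) (soApp l n fun i => Term.var i.1)))
        (soEq l m n))))
  | leibniz (l : Ar Θ) (m n : ℕ) (φ φ' : Fml Θ) : SORepl l m n φ φ' →
      Ax (soAll l m (soAll l n (imp (soEq l m n) (imp φ φ'))))
  | soAllElim (l : Ar Θ) (m n : ℕ) (φ : Fml Θ) : SOFreeFor l m n φ →
      Ax (imp (soAll l m φ) (soSubst l m n φ))
  | soAllImp (l : Ar Θ) (m : ℕ) (φ ψ : Fml Θ) : ¬ SOFreeIn l m φ →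
      Ax (imp (soAll l m (imp φ ψ)) (imp φ (soAll l m ψ)))
  | soAllScheme (l : Ar Θ) (m : ℕ) (θ : Scheme L l.1) (φ : Fml Θ) : θ ∈ Θ l.1 →
      Ax (imp (soAll l m φ) (schemeInst l m θ φ))

/-- The member `d i` of the sequence `d` is a premise or an axiom, or it comes from previous members by
modus ponens, by generalization (over a first-order or a second-order variable), or by the
infinitary rule: from `ψ → φ^θ` for all `θ ∈ Θ` of arity `l + 1`, infer `ψ → ∀ V^{l+1}_m φ`. -/
def Justified (Sig : Set (Fml Θ)) {ι : Type} [LT ι] (d : ι → Fml Θ) (i : ι) : Prop :=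
  d i ∈ Sig ∨ Ax (d i) ∨
  (∃ j k, j < i ∧ k < i ∧ d j = imp (d k) (d i)) ∨
  (∃ j x, j < i ∧ d i = all x (d j)) ∨
  (∃ j l m, j < i ∧ d i = soAll l m (d j)) ∨
  (∃ ψ l m φ, d i = imp ψ (soAll l m φ) ∧
    ∀ θ ∈ Θ l.1, ∃ j, j < i ∧ d j = imp ψ (schemeInst l m θ φ))

/-- `Σ ⊢ φ`: there is a deduction, that is, a countable (well-ordered, possibly transfinite) sequence of
formulas with last member `φ`, each of whose members is justified by previous ones. -/
def Proves (Sig : Set (Fml Θ)) (φ : Fml Θ) : Prop :=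
  ∃ (ι : Type) (_ : LinearOrder ι) (_ : WellFoundedLT ι) (_ : Countable ι) (last : ι)
    (d : ι → Fml Θ), IsTop last ∧ d last = φ ∧ ∀ i, Justified Sig d i

end Fml

/-! ### Standard structures -/

/-- `K_Θ^A` in arity `l + 1`: the relations on `A` that are definable with parameters by members
of `Θ`. -/
def K (Θ : Family L) (A : Type w) [L.Structure A] (l : ℕ) : Set (Set (Fin (l + 1) → A)) :=
  {B | ∃ θ ∈ Θ l, ∃ e : Fin θ.params → A, B = {d | θ.formula.Realize (Sum.elim d e)}}

namespace Fml

variable {Θ : Family L}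

/-- Satisfaction in the standard structure `(A, K_Θ^A)`, under an assignment `v` of elements to the
first-order variables and an assignment `S` of relations to the second-order variables. -/
def Sat {A : Type w} [L.Structure A] :
    (v : ℕ → A) → (S : (l : Ar Θ) → ℕ → Set (Fin (l.1 + 1) → A)) → Fml Θ → Prop
  | v, _, eq s t => s.realize v = t.realize v
  | v, _, rel R ts => Structure.RelMap R fun i => (ts i).realize v
  | _, S, soEq l m n => S l m = S l n
  | v, S, soApp l m ts => (fun i => (ts i).realize v) ∈ S l m
  | v, S, neg φ => ¬ Sat v S φ
  | v, S, and φ ψ => Sat v S φ ∧ Sat v S ψ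
  | v, S, all x φ => ∀ a : A, Sat (Function.update v x a) S φ
  | v, S, soAll l m φ =>
      ∀ B ∈ K Θ A l.1, Sat v (Function.update S l (Function.update (S l) m B)) φ

/-- `(A, K_Θ^A) ⊨ φ`: the formula holds under all assignments of elements of `A` and of members of
`K_Θ^A` to the variables (for a sentence this does not depend on the assignment). -/
def Holds (A : Type w) [L.Structure A] (φ : Fml Θ) : Prop :=
  ∀ (v : ℕ → A) (S : (l : Ar Θ) → ℕ → Set (Fin (l.1 + 1) → A)),
    (∀ l m, S l m ∈ K Θ A l.1) → Sat v S φ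

/-- `Σ ⊨ φ`: every standard structure (with non-empty domain) in which all members of `Σ` hold is one
in which `φ` holds. -/
def Entails (Sig : Set (Fml Θ)) (φ : Fml Θ) : Prop :=
  ∀ (A : Type w) [L.Structure A] [Nonempty A], (∀ σ ∈ Sig, Holds A σ) → Holds A φ

end Fml

end RestrictedSO

namespace RestrictedSO

open FirstOrder.Language

namespace Fml

variable {L : FirstOrder.Language.{u, v}} {Θ : Family L}

/-! ### Combining deductions -/

/-! The contrapositive is proved by a Henkin construction combined with an omitting-types argument.
Suppose that `Sig` does not prove φ. Formulas χ whose negation is not provable serve as forcing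
conditions, and ψ is a consequence of χ when `Sig` proves χ → ψ. A condition is a single formula, so
variables of both sorts that are fresh for it always remain. Generalization is unrestricted, so
these variables can play the role of Henkin constants. Starting from ¬φ, a directed family of
conditions meets countably many dense requirements (`exists_isHenkin`): every relevant formula is
decided, quantifiers of both sorts have witnesses, and for each V_n some θ ∈ Θ satisfies ∃ȳ ∀x̄
(V_n(x̄) ↔ θ(x̄, ȳ)).

The last requirement is where the infinitary rule enters (`Condition.exists_definable`). If χ
implied the negation of this statement for every θ, the rule would give χ → ∀V ¬∀x̄ (V_n(x̄) ↔
V(x̄)), and V_n itself put for V would refute χ.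

The vocabulary may be uncountable. Only a countable set U of symbols occurs in `Sig`, φ and Θ, and
completeness and witnesses are demanded for formulas over U alone.

The model consists of the variables modulo the equations in the resulting theory T, with relations
read off from atomic formulas. The truth lemma `IsTermModel.mem_iff_sat` for second-order
quantifiers presupposes that the relations named by the V_n are exactly the members of K. To avoid a
circle, truth is first obtained for plain formulas, without second-order quantifiers or equations.
From this the definability requirement yields that named relations lie in K
(`IsTermModel.termRel_mem_K`), and comprehension yields that all members of K are named
(`IsTermModel.exists_termRel_eq`). -/

theorem Justified.map {Sig : Set (Fml Θ)} {ι κ : Type} [LT ι] [LT κ] {d : ι → Fml Θ}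
    {d' : κ → Fml Θ} (g : ι → κ) (hg : ∀ i j, i < j → g i < g j) (hd : ∀ i, d' (g i) = d i) {i : ι}
    (h : Justified Sig d i) : Justified Sig d' (g i) := by
  rcases h with h | h | ⟨j, k, hj, hk, h⟩ | ⟨j, x, hj, h⟩ | ⟨j, l, m, hj, h⟩ | ⟨ψ, l, m, φ, h, hθ⟩
  · exact Or.inl (by rwa [hd])
  · exact Or.inr (Or.inl (by rwa [hd]))
  · exact Or.inr (Or.inr (Or.inl ⟨g j, g k, hg _ _ hj, hg _ _ hk, by rw [hd, hd, hd, h]⟩))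
  · exact Or.inr (Or.inr (Or.inr (Or.inl ⟨g j, x, hg _ _ hj, by rw [hd, hd, h]⟩)))
  · exact Or.inr (Or.inr (Or.inr (Or.inr (Or.inl ⟨g j, l, m, hg _ _ hj, by rw [hd, hd, h]⟩))))
  · refine Or.inr (Or.inr (Or.inr (Or.inr (Or.inr ⟨ψ, l, m, φ, by rw [hd, h], fun θ h' => ?_⟩))))
    obtain ⟨j, hj, hj'⟩ := hθ θ h'
    exact ⟨g j, hg _ _ hj, by rw [hd, hj']⟩

/-- Deductions are concatenated by placing well orders one after another along ℕ. The
well-foundedness of this sum follows from that of the lexicographic order on `PSigma`. -/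
theorem sigmaLex_wellFoundedLT {ι : ℕ → Type} [∀ n, LinearOrder (ι n)]
    [∀ n, WellFoundedLT (ι n)] : WellFoundedLT (Σₗ n, ι n) := by
  have h := WellFounded.psigma_lex (r := ((· < ·) : ℕ → ℕ → Prop))
    (s := fun n => ((· < ·) : ι n → ι n → Prop)) wellFounded_lt fun n => wellFounded_lt
  let f : (Σₗ n, ι n) → Σ' n, ι n := fun p => ⟨(ofLex p).1, (ofLex p).2⟩
  refine ⟨Subrelation.wf ?_ (InvImage.wf f h)⟩
  intro a b hab
  rcases hab with ⟨_, _, h⟩ | ⟨_, _, h⟩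
  · exact PSigma.Lex.left _ _ h
  · exact PSigma.Lex.right _ h

/-- A sequence of countably many provable formulas can be prolonged to a deduction of every formula
that is justified by them. -/
theorem Proves.of_seq {Sig : Set (Fml Θ)} {φ : Fml Θ} (f : ℕ → Fml Θ) (hf : ∀ n, Proves Sig (f n))
    (hj : ∀ {ι : Type} [LT ι] (d : ι → Fml Θ) (i : ι), d i = φ →
      (∀ n, ∃ j, j < i ∧ d j = f n) → Justified Sig d i) : Proves Sig φ := by
  choose ι o w c last d htop hlast hd using hf
  have := sigmaLex_wellFoundedLT (ι := ι)
  have hc : Countable (Σₗ n, ι n) := inferInstanceAs (Countable (Σ n, ι n))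
  -- All the given deductions stand one after another, and the new formula is put on top.
  let d' : WithTop (Σₗ n, ι n) → Fml Θ := fun p => WithTop.recTopCoe φ (fun p => d _ (ofLex p).2) p
  have hlt : ∀ n (i j : ι n), i < j →
      ((toLex ⟨n, i⟩ : Σₗ n, ι n) : WithTop (Σₗ n, ι n)) < (toLex ⟨n, j⟩ : Σₗ n, ι n) :=
    fun n i j hij => WithTop.coe_lt_coe.2 (Sigma.Lex.right _ _ hij)
  refine ⟨WithTop (Σₗ n, ι n), inferInstance, inferInstance,
    inferInstanceAs (Countable (Option (Σₗ n, ι n))), ⊤, d', fun _ => le_top, rfl, ?_⟩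
  intro i
  induction i using WithTop.recTopCoe with
  | top =>
    exact hj d' ⊤ rfl fun n =>
      ⟨(toLex ⟨n, last n⟩ : Σₗ n, ι n), WithTop.coe_lt_top _, hlast n⟩
  | coe p =>
    obtain ⟨n, i⟩ := p
    exact (hd n i).map (fun i => ((toLex ⟨n, i⟩ : Σₗ n, ι n) : WithTop (Σₗ n, ι n))) (hlt n)
      fun _ => rfl

variable {Sig : Set (Fml Θ)}

theorem Proves.of_justified {φ : Fml Θ}
    (hj : ∀ {ι : Type} [LT ι] (d : ι → Fml Θ) (i : ι), d i = φ → Justified Sig d i) :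
    Proves Sig φ :=
  ⟨Unit, inferInstance, inferInstance, inferInstance, (), fun _ => φ, fun _ => le_rfl, rfl,
    fun _ => hj _ _ rfl⟩

theorem Proves.premise {φ : Fml Θ} (h : φ ∈ Sig) : Proves Sig φ :=
  .of_justified fun _ _ hd => Or.inl (hd ▸ h)

theorem Proves.ax {φ : Fml Θ} (h : Ax φ) : Proves Sig φ :=
  .of_justified fun _ _ hd => Or.inr (Or.inl (hd ▸ h))

theorem Proves.mp {φ ψ : Fml Θ} (h : Proves Sig (imp φ ψ)) (h' : Proves Sig φ) : Proves Sig ψ := by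
  refine .of_seq (fun n => if n = 0 then imp φ ψ else φ) (fun n => ?_) fun d i hi hd => ?_
  · split_ifs <;> assumption
  · obtain ⟨j, hj, hj'⟩ := hd 0
    obtain ⟨k, hk, hk'⟩ := hd 1
    exact Or.inr (Or.inr (Or.inl ⟨j, k, hj, hk, by simp [hj', hk', hi]⟩))

theorem Proves.all {φ : Fml Θ} (x : ℕ) (h : Proves Sig φ) : Proves Sig (all x φ) := by
  refine .of_seq (fun _ => φ) (fun _ => h) fun d i hi hd => ?_
  obtain ⟨j, hj, hj'⟩ := hd 0
  exact Or.inr (Or.inr (Or.inr (Or.inl ⟨j, x, hj, by rw [hi, hj']⟩)))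

theorem Proves.soAll {φ : Fml Θ} (l : Ar Θ) (m : ℕ) (h : Proves Sig φ) :
    Proves Sig (soAll l m φ) := by
  refine .of_seq (fun _ => φ) (fun _ => h) fun d i hi hd => ?_
  obtain ⟨j, hj, hj'⟩ := hd 0
  exact Or.inr (Or.inr (Or.inr (Or.inr (Or.inl ⟨j, l, m, hj, by rw [hi, hj']⟩))))

theorem Proves.soAll_of_schemeInst {ψ φ : Fml Θ} {l : Ar Θ} {m : ℕ} (hΘ : (Θ l.1).Countable)
    (h : ∀ θ ∈ Θ l.1, Proves Sig (imp ψ (schemeInst l m θ φ))) :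
    Proves Sig (imp ψ (Fml.soAll l m φ)) := by
  -- Countability of Θ keeps the combined deduction countable. Arities in `Ar Θ` are inhabited, so ℕ
  -- enumerates the schemes.
  obtain ⟨e, he⟩ := hΘ.exists_eq_range l.2
  refine .of_seq (fun n => imp ψ (schemeInst l m (e n) φ))
    (fun n => h _ (he ▸ Set.mem_range_self n)) fun d i hi hd => ?_
  refine Or.inr (Or.inr (Or.inr (Or.inr (Or.inr ⟨ψ, l, m, φ, hi, fun θ hθ => ?_⟩))))
  rw [he] at hθ
  obtain ⟨n, rfl⟩ := hθ
  exact hd n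

theorem Proves.allBlock {φ : Fml Θ} (h : Proves Sig φ) (s n : ℕ) :
    Proves Sig (allBlock s n φ) := by
  induction n generalizing s with
  | zero => exact h
  | succ n ih => exact (ih (s + 1)).all s

/-! ### Propositional reasoning -/

/-- A truth assignment to all formulas that respects negation and conjunction. -/
structure IsValuation (val : Fml Θ → Prop) : Prop where
  neg : ∀ ψ, val (neg ψ) ↔ ¬ val ψ
  and : ∀ ψ χ, val (and ψ χ) ↔ val ψ ∧ val χ

theorem IsValuation.imp {val : Fml Θ → Prop} (h : IsValuation val) (ψ χ : Fml Θ) :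
    val (imp ψ χ) ↔ (val ψ → val χ) := by
  simp only [Fml.imp, h.neg, h.and]
  tauto

theorem IsValuation.iff {val : Fml Θ → Prop} (h : IsValuation val) (ψ χ : Fml Θ) :
    val (iff ψ χ) ↔ (val ψ ↔ val χ) := by
  simp only [Fml.iff, h.imp, h.and]
  tauto

/-- A set of formulas that contains all tautologies and is closed under modus ponens. -/
structure IsTheory (T : Set (Fml Θ)) : Prop where
  tautology : ∀ {φ}, (∀ val : Fml Θ → Prop, IsValuation val → val φ) → φ ∈ T
  mp : ∀ {φ ψ}, imp φ ψ ∈ T → φ ∈ T → ψ ∈ T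

namespace IsTheory

variable {T : Set (Fml Θ)}

theorem of_one (hT : IsTheory T) {φ ψ : Fml Θ}
    (h : ∀ val : Fml Θ → Prop, IsValuation val → val φ → val ψ)
    (hφ : φ ∈ T) : ψ ∈ T :=
  hT.mp (hT.tautology fun val hv => (hv.imp _ _).2 (h val hv)) hφ

theorem of_two (hT : IsTheory T) {φ ψ χ : Fml Θ}
    (h : ∀ val : Fml Θ → Prop, IsValuation val → val φ → val ψ → val χ)
    (hφ : φ ∈ T) (hψ : ψ ∈ T) : χ ∈ T :=
  hT.mp (hT.of_one (fun val hv h' => (hv.imp _ _).2 (h val hv h')) hφ) hψ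

end IsTheory

theorem isTheory_proves (Sig : Set (Fml Θ)) : IsTheory {φ | Proves Sig φ} where
  tautology h := .ax (.tautology _ fun val hn ha => h val ⟨hn, ha⟩)
  mp h h' := Proves.mp h h'

theorem Proves.of_one {φ ψ : Fml Θ} (h : ∀ val : Fml Θ → Prop, IsValuation val → val φ → val ψ)
    (hφ : Proves Sig φ) : Proves Sig ψ :=
  (isTheory_proves Sig).of_one h hφ

theorem Proves.of_two {φ ψ χ : Fml Θ}
    (h : ∀ val : Fml Θ → Prop, IsValuation val → val φ → val ψ → val χ)
    (hφ : Proves Sig φ) (hψ : Proves Sig ψ) : Proves Sig χ :=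
  (isTheory_proves Sig).of_two h hφ hψ

theorem Proves.taut {φ : Fml Θ} (h : ∀ val : Fml Θ → Prop, IsValuation val → val φ) :
    Proves Sig φ :=
  (isTheory_proves Sig).tautology h

theorem Proves.imp_trans {φ ψ χ : Fml Θ} (h : Proves Sig (imp φ ψ)) (h' : Proves Sig (imp ψ χ)) :
    Proves Sig (imp φ χ) :=
  .of_two (fun val hv => by simp only [hv.imp]; tauto) h h'

theorem Proves.imp_all {φ ψ : Fml Θ} {x : ℕ} (hx : ¬ FreeIn x φ) (h : Proves Sig (imp φ ψ)) :
    Proves Sig (imp φ (Fml.all x ψ)) :=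
  (Proves.ax (.allImp x φ ψ hx)).mp (h.all x)

theorem Proves.imp_soAll {φ ψ : Fml Θ} {l : Ar Θ} {m : ℕ} (hm : ¬ SOFreeIn l m φ)
    (h : Proves Sig (imp φ ψ)) : Proves Sig (imp φ (Fml.soAll l m ψ)) :=
  (Proves.ax (.soAllImp l m φ ψ hm)).mp (h.soAll l m)

end Fml

/-! ### Terms -/

section Terms

variable {L : FirstOrder.Language.{u, v}}

theorem mem_varFinset_func {n : ℕ} {f : L.Functions n} {ts : Fin n → L.Term ℕ} {x : ℕ} :
    x ∈ (Term.func f ts).varFinset ↔ ∃ i, x ∈ (ts i).varFinset := by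
  simp [Term.varFinset]

theorem mem_varFinset_var {x y : ℕ} : x ∈ (Term.var y : L.Term ℕ).varFinset ↔ x = y := by
  simp [Term.varFinset]

theorem lt_of_mem_varFinset {t : L.Term ℕ} {x : ℕ} (h : x ∈ t.varFinset) :
    x < t.varFinset.sup (· + 1) :=
  Finset.le_sup (f := (· + 1)) h

theorem lt_of_mem_varFinset_of_fin {n : ℕ} {ts : Fin n → L.Term ℕ} {i : Fin n} {x : ℕ}
    (h : x ∈ (ts i).varFinset) :
    x < Finset.univ.sup fun i => (ts i).varFinset.sup (· + 1) :=
  (lt_of_mem_varFinset h).trans_le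
    (Finset.le_sup (f := fun i => (ts i).varFinset.sup (· + 1)) (Finset.mem_univ i))

theorem term_subst_of_notMem {t : L.Term ℕ} {x : ℕ} {r : L.Term ℕ} (h : x ∉ t.varFinset) :
    t.subst (Function.update Term.var x r) = t := by
  induction t with
  | var y =>
    rw [mem_varFinset_var] at h
    simp [Term.subst, Ne.symm h]
  | func f ts ih =>
    rw [mem_varFinset_func, not_exists] at h
    simp only [Term.subst]
    congr 1
    exact funext fun i => ih i (h i)

theorem term_subst_subst {t : L.Term ℕ} {x y : ℕ} (h : y ∉ t.varFinset) :
    (t.subst (Function.update Term.var x (Term.var y))).subst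
      (Function.update Term.var y (Term.var x)) = t := by
  induction t with
  | var z =>
    rw [mem_varFinset_var] at h
    rcases eq_or_ne z x with rfl | hz
    · simp [Term.subst]
    · simp [Term.subst, hz, Ne.symm h]
  | func f ts ih =>
    rw [mem_varFinset_func, not_exists] at h
    simp only [Term.subst]
    congr 1
    exact funext fun i => ih i (h i)

theorem notMem_varFinset_subst {t : L.Term ℕ} {x y : ℕ} (h : x ≠ y) :
    x ∉ (t.subst (Function.update Term.var x (Term.var y))).varFinset := by
  induction t with
  | var z =>
    rcases eq_or_ne z x with rfl | hz
    · simpa [Term.subst, mem_varFinset_var] using h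
    · simpa [Term.subst, hz, mem_varFinset_var] using hz.symm
  | func f ts ih =>
    simp only [Term.subst, mem_varFinset_func, not_exists]
    exact ih

theorem term_realize_congr {A : Type w} [L.Structure A] {t : L.Term ℕ} {a b : ℕ → A}
    (h : ∀ x ∈ t.varFinset, a x = b x) : t.realize a = t.realize b := by
  induction t with
  | var x => exact h x (mem_varFinset_var.2 rfl)
  | func f ts ih =>
    simp only [Term.realize]
    congr 1
    exact funext fun i => ih i fun x hx => h x (mem_varFinset_func.2 ⟨i, hx⟩)

theorem term_realize_subst {A : Type w} [L.Structure A] {t r : L.Term ℕ} {a : ℕ → A} {x : ℕ} :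
    (t.subst (Function.update Term.var x r)).realize a =
      t.realize (Function.update a x (r.realize a)) := by
  rw [Term.realize_subst]
  congr 1
  funext z
  rcases eq_or_ne z x with rfl | hz
  · simp
  · simp [hz]

end Terms

namespace Fml

variable {L : FirstOrder.Language.{u, v}} {Θ : Family L}

/-! ### Fresh first-order variables -/

theorem FreeIn.lt_varBound {φ : Fml Θ} {x : ℕ} (h : FreeIn x φ) : x < varBound φ := by
  induction φ with
  | eq s t =>
    simp only [varBound, lt_max_iff]
    exact h.imp lt_of_mem_varFinset lt_of_mem_varFinset
  | rel R ts => obtain ⟨i, hi⟩ := h; exact lt_of_mem_varFinset_of_fin hi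
  | soEq l m n => exact h.elim
  | soApp l m ts => obtain ⟨i, hi⟩ := h; exact lt_of_mem_varFinset_of_fin hi
  | neg φ ih => exact ih h
  | and φ ψ ihφ ihψ =>
    simp only [varBound, lt_max_iff]
    exact Or.imp ihφ ihψ h
  | all y φ ih =>
    simp only [varBound, lt_max_iff]
    exact Or.inr (ih h.2)
  | soAll l m φ ih => exact ih h

theorem freeFor_of_varBound_le {φ : Fml Θ} {x y : ℕ} (h : varBound φ ≤ y) :
    FreeFor x (Term.var y) φ := by
  induction φ with
  | eq | rel | soEq | soApp => trivial
  | neg φ ih => exact ih h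
  | and φ ψ ihφ ihψ =>
    simp only [varBound, max_le_iff] at h
    exact ⟨ihφ h.1, ihψ h.2⟩
  | all z φ ih =>
    simp only [varBound, max_le_iff] at h
    refine fun _ => ⟨?_, ih h.2⟩
    rw [mem_varFinset_var]
    omega
  | soAll l m φ ih => exact ih h

theorem subst_of_not_freeIn {φ : Fml Θ} {x : ℕ} {t : L.Term ℕ} (h : ¬ FreeIn x φ) :
    subst x t φ = φ := by
  induction φ with
  | eq s r =>
    simp only [FreeIn, not_or] at h
    simp only [subst, term_subst_of_notMem h.1, term_subst_of_notMem h.2]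
  | rel R ts =>
    simp only [FreeIn, not_exists] at h
    simp only [subst, term_subst_of_notMem (h _)]
  | soEq l m n => rfl
  | soApp l m ts =>
    simp only [FreeIn, not_exists] at h
    simp only [subst, term_subst_of_notMem (h _)]
  | neg φ ih => simp only [subst, ih h]
  | and φ ψ ihφ ihψ =>
    simp only [FreeIn, not_or] at h
    simp only [subst, ihφ h.1, ihψ h.2]
  | all z φ ih =>
    by_cases hz : z = x
    · simp only [subst, hz, if_true]
    · simp only [subst, hz, if_false, ih fun h' => h ⟨Ne.symm hz, h'⟩]
  | soAll l m φ ih => simp only [subst, ih h]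

/-- A variable beyond all indices in φ, bound ones included, marks exactly the former free
occurrences of x, so the renaming can be undone. Hence ∀y φ(x/y) implies ∀x φ. -/
theorem subst_subst_of_varBound_le {φ : Fml Θ} {x y : ℕ} (h : varBound φ ≤ y) :
    subst y (Term.var x) (subst x (Term.var y) φ) = φ := by
  have ht : ∀ t : L.Term ℕ, t.varFinset.sup (· + 1) ≤ y → y ∉ t.varFinset :=
    fun t ht hy => absurd (lt_of_mem_varFinset hy) (by omega)
  have hts : ∀ {n : ℕ} (ts : Fin n → L.Term ℕ),
      (Finset.univ.sup fun i => (ts i).varFinset.sup (· + 1)) ≤ y → ∀ i, y ∉ (ts i).varFinset :=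
    fun ts hts i hy => absurd (lt_of_mem_varFinset_of_fin hy) (by omega)
  induction φ with
  | eq s t =>
    simp only [varBound, max_le_iff] at h
    simp only [subst, term_subst_subst (ht _ h.1), term_subst_subst (ht _ h.2)]
  | rel R ts => simp only [subst, term_subst_subst (hts _ h _)]
  | soEq l m n => rfl
  | soApp l m ts => simp only [subst, term_subst_subst (hts _ h _)]
  | neg φ ih => simp only [subst, ih h]
  | and φ ψ ihφ ihψ =>
    simp only [varBound, max_le_iff] at h
    simp only [subst, ihφ h.1, ihψ h.2]
  | all z φ ih =>
    by_cases hz : z = x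
    · have hy : ¬ FreeIn y (all z φ) := fun h' => absurd h'.lt_varBound (by omega)
      rw [subst, if_pos hz, subst_of_not_freeIn hy]
    · simp only [varBound, max_le_iff] at h
      have hzy : z ≠ y := by omega
      simp only [subst, hz, if_false, hzy, ih h.2]
  | soAll l m φ ih => simp only [subst, ih h]

theorem freeFor_subst_of_varBound_le {φ : Fml Θ} {x y : ℕ} (h : varBound φ ≤ y) :
    FreeFor y (Term.var x) (subst x (Term.var y) φ) := by
  induction φ with
  | eq | rel | soEq | soApp => trivial
  | neg φ ih => exact ih h
  | and φ ψ ihφ ihψ =>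
    simp only [varBound, max_le_iff] at h
    exact ⟨ihφ h.1, ihψ h.2⟩
  | all z φ ih =>
    by_cases hz : z = x
    · have hy : ¬ FreeIn y (all z φ) := fun h' => absurd h'.lt_varBound (by omega)
      rw [subst, if_pos hz]
      exact fun h' => (hy h').elim
    · simp only [varBound, max_le_iff] at h
      rw [subst, if_neg hz]
      exact fun _ => ⟨by rwa [mem_varFinset_var], ih h.2⟩
  | soAll l m φ ih => exact ih h

theorem not_freeIn_subst {φ : Fml Θ} {x y : ℕ} (h : x ≠ y) :
    ¬ FreeIn x (subst x (Term.var y) φ) := by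
  induction φ with
  | eq s t =>
    simp only [subst, FreeIn, notMem_varFinset_subst h, or_self, not_false_eq_true]
  | rel R ts =>
    simp only [subst, FreeIn, notMem_varFinset_subst h, exists_false, not_false_eq_true]
  | soEq l m n => exact not_false
  | soApp l m ts =>
    simp only [subst, FreeIn, notMem_varFinset_subst h, exists_false, not_false_eq_true]
  | neg φ ih => exact ih
  | and φ ψ ihφ ihψ => exact not_or.2 ⟨ihφ, ihψ⟩
  | all z φ ih =>
    by_cases hz : z = x
    · rw [subst, if_pos hz]
      exact fun h' => h'.1 hz.symm
    · rw [subst, if_neg hz]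
      exact fun h' => ih h'.2
  | soAll l m φ ih => exact ih

/-- Generalization on a constant: a fresh variable may be replaced by a quantified one. -/
theorem Proves.imp_all_of_fresh {Sig : Set (Fml Θ)} {χ ψ : Fml Θ} {x y : ℕ}
    (hχ : varBound χ ≤ y) (hψ : varBound (Fml.all x ψ) ≤ y)
    (h : Proves Sig (imp χ (subst x (Term.var y) ψ))) : Proves Sig (imp χ (Fml.all x ψ)) := by
  simp only [varBound, max_le_iff] at hψ
  have hx : x ≠ y := by omega
  -- Generalize over y, which is fresh for χ, and then pass to the alphabetic variant ∀x ψ. The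
  -- members of `Sig` need not avoid y.
  refine (h.imp_all (x := y) fun h' => absurd h'.lt_varBound (by omega)).imp_trans ?_
  refine Proves.imp_all (fun h' => not_freeIn_subst hx h'.2) ?_
  have := Proves.ax (Sig := Sig) (.allElim y (Term.var x) _ (freeFor_subst_of_varBound_le hψ.2))
  rwa [subst_subst_of_varBound_le hψ.2] at this

/-! ### Fresh second-order variables -/

/-- A strict upper bound for the indices of all second-order variables, free or bound, in `φ`. -/
def soBound : Fml Θ → ℕ
  | eq _ _ => 0
  | rel _ _ => 0
  | soEq _ m n => max (m + 1) (n + 1)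
  | soApp _ m _ => m + 1
  | neg φ => soBound φ
  | and φ ψ => max (soBound φ) (soBound ψ)
  | all _ φ => soBound φ
  | soAll _ m φ => max (m + 1) (soBound φ)

theorem SOFreeIn.lt_soBound {φ : Fml Θ} {l : Ar Θ} {m : ℕ} (h : SOFreeIn l m φ) :
    m < soBound φ := by
  induction φ with
  | eq | rel => exact h.elim
  | soEq l' i j =>
    obtain ⟨-, h⟩ := h
    simp only [soBound]
    omega
  | soApp l' i ts =>
    obtain ⟨-, h⟩ := h
    simp only [soBound]
    omega
  | neg φ ih => exact ih h
  | and φ ψ ihφ ihψ =>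
    simp only [soBound, lt_max_iff]
    exact Or.imp ihφ ihψ h
  | all y φ ih => exact ih h
  | soAll l' i φ ih =>
    simp only [soBound, lt_max_iff]
    exact Or.inr (ih h.2)

theorem soFreeFor_of_soBound_le {φ : Fml Θ} {l : Ar Θ} {m n : ℕ} (h : soBound φ ≤ n) :
    SOFreeFor l m n φ := by
  induction φ with
  | eq | rel | soEq | soApp => trivial
  | neg φ ih => exact ih h
  | and φ ψ ihφ ihψ =>
    simp only [soBound, max_le_iff] at h
    exact ⟨ihφ h.1, ihψ h.2⟩
  | all z φ ih => exact ih h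
  | soAll l' i φ ih =>
    simp only [soBound, max_le_iff] at h
    exact fun _ => ⟨fun h' => by omega, ih h.2⟩

theorem soSubst_of_not_soFreeIn {φ : Fml Θ} {l : Ar Θ} {m n : ℕ} (h : ¬ SOFreeIn l m φ) :
    soSubst l m n φ = φ := by
  induction φ with
  | eq | rel => rfl
  | soEq l' i j =>
    by_cases hl : l' = l
    · simp only [SOFreeIn, hl, true_and, not_or] at h
      simp only [soSubst, if_neg h.1, if_neg h.2, ite_self]
    · simp only [soSubst, if_neg hl]
  | soApp l' i ts => simp only [soSubst, if_neg (show ¬ (l' = l ∧ i = m) from h)]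
  | neg φ ih => simp only [soSubst, ih h]
  | and φ ψ ihφ ihψ =>
    simp only [SOFreeIn, not_or] at h
    simp only [soSubst, ihφ h.1, ihψ h.2]
  | all z φ ih => simp only [soSubst, ih h]
  | soAll l' i φ ih =>
    by_cases hi : l' = l ∧ i = m
    · rw [soSubst, if_pos hi]
    · rw [soSubst, if_neg hi, ih fun h' => h ⟨hi, h'⟩]

theorem soSubst_self {φ : Fml Θ} {l : Ar Θ} {m : ℕ} : soSubst l m m φ = φ := by
  have hm : ∀ i, (if i = m then m else i) = i := fun i => by split_ifs with h <;> simp [h]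
  induction φ with
  | eq | rel => rfl
  | soEq l' i j => simp only [soSubst, hm, ite_self]
  | soApp l' i ts =>
    simp only [soSubst]
    split_ifs with h
    · rw [h.2]
    · rfl
  | neg φ ih => simp only [soSubst, ih]
  | and φ ψ ihφ ihψ => simp only [soSubst, ihφ, ihψ]
  | all z φ ih => simp only [soSubst, ih]
  | soAll l' i φ ih => simp only [soSubst, ih, ite_self]

theorem soFreeFor_self {φ : Fml Θ} {l : Ar Θ} {m : ℕ} : SOFreeFor l m m φ := by
  induction φ with
  | eq | rel | soEq | soApp => trivial
  | neg φ ih => exact ih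
  | and φ ψ ihφ ihψ => exact ⟨ihφ, ihψ⟩
  | all z φ ih => exact ih
  | soAll l' i φ ih => exact fun h => ⟨h.1, ih⟩

theorem soSubst_soSubst_of_soBound_le {φ : Fml Θ} {l : Ar Θ} {m n : ℕ} (h : soBound φ ≤ n) :
    soSubst l n m (soSubst l m n φ) = φ := by
  have hm : ∀ i, i + 1 ≤ n → (if (if i = m then n else i) = n then m
      else (if i = m then n else i)) = i := fun i hi => by split_ifs <;> omega
  induction φ with
  | eq | rel => rfl
  | soEq l' i j =>
    simp only [soBound, max_le_iff] at h
    by_cases hl : l' = l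
    · simp only [soSubst, hl, if_true, hm i h.1, hm j h.2]
    · simp only [soSubst, hl, if_false]
  | soApp l' i ts =>
    simp only [soBound] at h
    by_cases hl : l' = l
    · simp only [soSubst, hl, true_and, hm i h]
    · simp only [soSubst, hl, false_and, if_false]
  | neg φ ih => simp only [soSubst, ih h]
  | and φ ψ ihφ ihψ =>
    simp only [soBound, max_le_iff] at h
    simp only [soSubst, ihφ h.1, ihψ h.2]
  | all z φ ih => simp only [soSubst, ih h]
  | soAll l' i φ ih =>
    by_cases hi : l' = l ∧ i = m
    · have hn : ¬ SOFreeIn l n (soAll l' i φ) := fun h' => absurd h'.lt_soBound (by omega)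
      rw [soSubst, if_pos hi, soSubst_of_not_soFreeIn hn]
    · simp only [soBound, max_le_iff] at h
      have hn : ¬ (l' = l ∧ i = n) := fun h' => by omega
      simp only [soSubst, hi, if_false, hn, ih h.2]

theorem soFreeFor_soSubst_of_soBound_le {φ : Fml Θ} {l : Ar Θ} {m n : ℕ} (h : soBound φ ≤ n) :
    SOFreeFor l n m (soSubst l m n φ) := by
  induction φ with
  | eq | rel | soApp => trivial
  | soEq l' i j =>
    rw [soSubst]
    split_ifs <;> trivial
  | neg φ ih => exact ih h
  | and φ ψ ihφ ihψ =>
    simp only [soBound, max_le_iff] at h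
    exact ⟨ihφ h.1, ihψ h.2⟩
  | all z φ ih => exact ih h
  | soAll l' i φ ih =>
    by_cases hi : l' = l ∧ i = m
    · have hn : ¬ SOFreeIn l n (soAll l' i φ) := fun h' => absurd h'.lt_soBound (by omega)
      rw [soSubst, if_pos hi]
      exact fun h' => (hn h').elim
    · simp only [soBound, max_le_iff] at h
      rw [soSubst, if_neg hi]
      exact fun _ => ⟨hi, ih h.2⟩

theorem not_soFreeIn_soSubst {φ : Fml Θ} {l : Ar Θ} {m n : ℕ} (h : m ≠ n) :
    ¬ SOFreeIn l m (soSubst l m n φ) := by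
  induction φ with
  | eq | rel => exact not_false
  | soEq l' i j =>
    rw [soSubst]
    split_ifs <;> rintro ⟨h1, h2⟩ <;> first | contradiction | omega
  | soApp l' i ts =>
    rw [soSubst]
    split_ifs with hi
    · exact fun h' => h h'.2.symm
    · exact hi
  | neg φ ih => exact ih
  | and φ ψ ihφ ihψ => exact not_or.2 ⟨ihφ, ihψ⟩
  | all z φ ih => exact ih
  | soAll l' i φ ih =>
    by_cases hi : l' = l ∧ i = m
    · rw [soSubst, if_pos hi]
      exact fun h' => h'.1 hi
    · rw [soSubst, if_neg hi]
      exact fun h' => ih h'.2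

/-- The second-order form of generalization on a constant: quantify over the fresh V_n and rename it
back to V_m. -/
theorem Proves.imp_soAll_of_fresh {Sig : Set (Fml Θ)} {χ ψ : Fml Θ} {l : Ar Θ} {m n : ℕ}
    (hχ : soBound χ ≤ n) (hψ : soBound (Fml.soAll l m ψ) ≤ n)
    (h : Proves Sig (imp χ (soSubst l m n ψ))) : Proves Sig (imp χ (Fml.soAll l m ψ)) := by
  simp only [soBound, max_le_iff] at hψ
  have hm : m ≠ n := by omega
  refine (h.imp_soAll (l := l) (m := n) fun h' => absurd h'.lt_soBound (by omega)).imp_trans ?_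
  refine Proves.imp_soAll (fun h' => not_soFreeIn_soSubst hm h'.2) ?_
  have := Proves.ax (Sig := Sig) (.soAllElim l n m _ (soFreeFor_soSubst_of_soBound_le hψ.2))
  rwa [soSubst_soSubst_of_soBound_le hψ.2] at this

/-! ### Size of formulas -/

/-- The truth lemma passes from a quantified formula to substitution instances, which are not
subformulas. It therefore runs by induction on this measure, which substitution of variables
preserves. -/
def size : Fml Θ → ℕ
  | eq _ _ => 0
  | rel _ _ => 0
  | soEq _ _ _ => 0
  | soApp _ _ _ => 0
  | neg φ => size φ + 1
  | and φ ψ => size φ + size ψ + 1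
  | all _ φ => size φ + 1
  | soAll _ _ φ => size φ + 1

theorem size_subst {φ : Fml Θ} {x : ℕ} {t : L.Term ℕ} : size (subst x t φ) = size φ := by
  induction φ with
  | eq | rel | soEq | soApp => rfl
  | neg φ ih | soAll l m φ ih => simp only [subst, size, ih]
  | and φ ψ ihφ ihψ => simp only [subst, size, ihφ, ihψ]
  | all z φ ih =>
    rw [subst]
    split_ifs
    · rfl
    · simp only [size, ih]

theorem size_soSubst {φ : Fml Θ} {l : Ar Θ} {m n : ℕ} : size (soSubst l m n φ) = size φ := by
  induction φ with
  | eq | rel | soApp => rfl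
  | soEq l' i j =>
    rw [soSubst]
    split_ifs <;> rfl
  | neg φ ih | all z φ ih => simp only [soSubst, size, ih]
  | and φ ψ ihφ ihψ => simp only [soSubst, size, ihφ, ihψ]
  | soAll l' i φ ih =>
    rw [soSubst]
    split_ifs
    · rfl
    · simp only [size, ih]

/-! ### Blocks of quantifiers -/

theorem subst_allBlock {φ : Fml Θ} {x s n : ℕ} {t : L.Term ℕ} (h : x < s) :
    subst x t (allBlock s n φ) = allBlock s n (subst x t φ) := by
  induction n generalizing s with
  | zero => rfl
  | succ n ih => rw [allBlock, subst, if_neg (by omega), ih (by omega), allBlock]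

theorem soSubst_allBlock {φ : Fml Θ} {l : Ar Θ} {m n s k : ℕ} :
    soSubst l m n (allBlock s k φ) = allBlock s k (soSubst l m n φ) := by
  induction k generalizing s with
  | zero => rfl
  | succ k ih => rw [allBlock, soSubst, ih, allBlock]

theorem soFreeFor_allBlock {φ : Fml Θ} {l : Ar Θ} {m n s k : ℕ} (h : SOFreeFor l m n φ) :
    SOFreeFor l m n (allBlock s k φ) := by
  induction k generalizing s with
  | zero => exact h
  | succ k ih => exact ih

theorem schemeSubst_allBlock {φ : Fml Θ} {l : Ar Θ} {m s k N : ℕ} {θ : Scheme L l.1} :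
    schemeSubst l m θ N (allBlock s k φ) = allBlock s k (schemeSubst l m θ N φ) := by
  induction k generalizing s with
  | zero => rfl
  | succ k ih => rw [allBlock, schemeSubst, ih, allBlock]

theorem varBound_allBlock {φ : Fml Θ} {s k : ℕ} :
    varBound φ ≤ varBound (allBlock s k φ) ∧ (0 < k → s + k ≤ varBound (allBlock s k φ)) := by
  induction k generalizing s with
  | zero => exact ⟨le_rfl, fun h => absurd h (lt_irrefl _)⟩
  | succ k ih =>
    simp only [allBlock, varBound]
    obtain ⟨h1, h2⟩ := ih (s := s + 1)
    refine ⟨le_max_of_le_right h1, fun _ => ?_⟩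
    rcases Nat.eq_zero_or_pos k with rfl | hk
    · exact le_max_left _ _
    · exact le_max_of_le_right (by have := h2 hk; omega)

end Fml

/-! ### Symbols -/

section Symbols

variable {L : FirstOrder.Language.{u, v}}

/-- The function and relation symbols of a vocabulary. -/
abbrev Symb (L : FirstOrder.Language.{u, v}) := (Σ n, L.Functions n) ⊕ (Σ n, L.Relations n)

def termSyms {α : Type} : L.Term α → Set (Symb L)
  | .var _ => ∅
  | .func f ts => insert (Sum.inl ⟨_, f⟩) (⋃ i, termSyms (ts i))

def boundedSyms {α : Type} : {n : ℕ} → L.BoundedFormula α n → Set (Symb L)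
  | _, .falsum => ∅
  | _, .equal s t => termSyms s ∪ termSyms t
  | _, .rel R ts => insert (Sum.inr ⟨_, R⟩) (⋃ i, termSyms (ts i))
  | _, .imp φ ψ => boundedSyms φ ∪ boundedSyms ψ
  | _, .all φ => boundedSyms φ

theorem countable_termSyms {α : Type} (t : L.Term α) : (termSyms t).Countable := by
  induction t with
  | var => exact Set.countable_empty
  | func f ts ih => exact (Set.countable_iUnion ih).insert _

theorem countable_boundedSyms {α : Type} {n : ℕ} (φ : L.BoundedFormula α n) :
    (boundedSyms φ).Countable := by
  induction φ with
  | falsum => exact Set.countable_empty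
  | equal s t => exact (countable_termSyms s).union (countable_termSyms t)
  | rel R ts => exact (Set.countable_iUnion fun i => countable_termSyms (ts i)).insert _
  | imp φ ψ ihφ ihψ => exact ihφ.union ihψ
  | all φ ih => exact ih

theorem termSyms_subst_subset {α β : Type} {t : L.Term α} {f : α → L.Term β} {U : Set (Symb L)}
    (ht : termSyms t ⊆ U) (hf : ∀ a, termSyms (f a) ⊆ U) : termSyms (t.subst f) ⊆ U := by
  induction t with
  | var a => exact hf a
  | func g ts ih =>
    simp only [termSyms, Set.insert_subset_iff, Set.iUnion_subset_iff, Term.subst] at ht ⊢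
    exact ⟨ht.1, fun i => ih i (ht.2 i)⟩

/-- The terms over the symbols in `U` of depth below `n`. -/
def termStage (U : Set (Symb L)) : ℕ → Set (L.Term ℕ)
  | 0 => Set.range Term.var
  | n + 1 => termStage U n ∪ ⋃ f ∈ {f : Σ k, L.Functions k | Sum.inl f ∈ U},
      Term.func f.2 '' {ts | ∀ i, ts i ∈ termStage U n}

theorem countable_pi_fin {α : Type*} {S : Set α} (hS : S.Countable) (k : ℕ) :
    {ts : Fin k → α | ∀ i, ts i ∈ S}.Countable :=
  Set.countable_pi fun _ => hS

theorem countable_termStage {U : Set (Symb L)} (hU : U.Countable) (n : ℕ) :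
    (termStage U n).Countable := by
  induction n with
  | zero => exact Set.countable_range _
  | succ n ih =>
    refine ih.union ((hU.preimage Sum.inl_injective).biUnion fun f _ => ?_)
    exact (countable_pi_fin ih _).image _

theorem termStage_mono (U : Set (Symb L)) : Monotone (termStage U) :=
  monotone_nat_of_le_succ fun _ => Set.subset_union_left

theorem exists_mem_termStage {U : Set (Symb L)} {t : L.Term ℕ} (h : termSyms t ⊆ U) :
    ∃ n, t ∈ termStage U n := by
  induction t with
  | var x => exact ⟨0, x, rfl⟩
  | func f ts ih =>
    simp only [termSyms, Set.insert_subset_iff, Set.iUnion_subset_iff] at h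
    choose n hn using fun i => ih i (h.2 i)
    refine ⟨Finset.univ.sup n + 1, Or.inr ?_⟩
    simp only [Set.mem_iUnion]
    exact ⟨⟨_, f⟩, h.1, ts, fun i => termStage_mono U (Finset.le_sup (Finset.mem_univ i)) (hn i),
      rfl⟩

theorem countable_terms {U : Set (Symb L)} (hU : U.Countable) :
    {t : L.Term ℕ | termSyms t ⊆ U}.Countable :=
  (Set.countable_iUnion fun n => countable_termStage hU n).mono fun _ h =>
    Set.mem_iUnion.2 (exists_mem_termStage h)

end Symbols

namespace Fml

variable {L : FirstOrder.Language.{u, v}} {Θ : Family L}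

/-! ### Countably many formulas over a countable set of symbols -/

def syms : Fml Θ → Set (Symb L)
  | eq s t => termSyms s ∪ termSyms t
  | rel R ts => insert (Sum.inr ⟨_, R⟩) (⋃ i, termSyms (ts i))
  | soEq _ _ _ => ∅
  | soApp _ _ ts => ⋃ i, termSyms (ts i)
  | neg φ => syms φ
  | and φ ψ => syms φ ∪ syms ψ
  | all _ φ => syms φ
  | soAll _ _ φ => syms φ

theorem countable_syms (φ : Fml Θ) : (syms φ).Countable := by
  induction φ with
  | eq s t => exact (countable_termSyms s).union (countable_termSyms t)
  | rel R ts => exact (Set.countable_iUnion fun i => countable_termSyms (ts i)).insert _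
  | soEq => exact Set.countable_empty
  | soApp l m ts => exact Set.countable_iUnion fun i => countable_termSyms (ts i)
  | neg φ ih | all x φ ih | soAll l m φ ih => exact ih
  | and φ ψ ihφ ihψ => exact ihφ.union ihψ

theorem syms_subst_subset {φ : Fml Θ} {x y : ℕ} {U : Set (Symb L)} (h : syms φ ⊆ U) :
    syms (subst x (Term.var y) φ) ⊆ U := by
  have hv : ∀ z, termSyms (Function.update Term.var x (Term.var y : L.Term ℕ) z) ⊆ U := fun z => by
    rcases eq_or_ne z x with rfl | hz
    · simp [termSyms]
    · simp [hz, termSyms]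
  induction φ with
  | eq s t =>
    simp only [syms, subst, Set.union_subset_iff] at h ⊢
    exact ⟨termSyms_subst_subset h.1 hv, termSyms_subst_subset h.2 hv⟩
  | rel R ts =>
    simp only [syms, subst, Set.insert_subset_iff, Set.iUnion_subset_iff] at h ⊢
    exact ⟨h.1, fun i => termSyms_subst_subset (h.2 i) hv⟩
  | soEq => exact h
  | soApp l m ts =>
    simp only [syms, subst, Set.iUnion_subset_iff] at h ⊢
    exact fun i => termSyms_subst_subset (h i) hv
  | neg φ ih | soAll l m φ ih => exact ih h
  | all z φ ih =>
    rw [subst]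
    split_ifs
    · exact h
    · exact ih h
  | and φ ψ ihφ ihψ =>
    simp only [syms, subst, Set.union_subset_iff] at h ⊢
    exact ⟨ihφ h.1, ihψ h.2⟩

theorem syms_soSubst {φ : Fml Θ} {l : Ar Θ} {m n : ℕ} : syms (soSubst l m n φ) = syms φ := by
  induction φ with
  | eq | rel | soApp => rfl
  | soEq l' i j =>
    rw [soSubst]
    split_ifs <;> rfl
  | neg φ ih | all z φ ih => simp only [soSubst, syms, ih]
  | and φ ψ ihφ ihψ => simp only [soSubst, syms, ihφ, ihψ]
  | soAll l' i φ ih =>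
    rw [soSubst]
    split_ifs
    · rfl
    · simp only [syms, ih]

theorem syms_allBlock {φ : Fml Θ} {s n : ℕ} : syms (allBlock s n φ) = syms φ := by
  induction n generalizing s with
  | zero => rfl
  | succ n ih => exact ih

theorem syms_imp {φ ψ : Fml Θ} : syms (imp φ ψ) = syms φ ∪ syms ψ := rfl

theorem syms_iff {φ ψ : Fml Θ} : syms (iff φ ψ) = syms φ ∪ syms ψ := by
  simp only [iff, syms, syms_imp, Set.union_comm (syms ψ), Set.union_self]

theorem syms_ofFO_subset {α : Type} {b : ℕ} {σ : α → L.Term ℕ} {n : ℕ} {φ : L.BoundedFormula α n}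
    {U : Set (Symb L)} (h : boundedSyms φ ⊆ U) (hσ : ∀ a, termSyms (σ a) ⊆ U) :
    syms (ofFO b σ φ : Fml Θ) ⊆ U := by
  have hv : ∀ {n : ℕ} (z : α ⊕ Fin n),
      termSyms (Sum.elim σ (fun i => (Term.var (b + i.1) : L.Term ℕ)) z) ⊆ U := fun z => by
    rcases z with a | i
    · exact hσ a
    · exact Set.empty_subset _
  induction φ with
  | falsum => simp [ofFO, bot, syms, termSyms]
  | equal s t =>
    simp only [boundedSyms, ofFO, syms, Set.union_subset_iff] at h ⊢
    exact ⟨termSyms_subst_subset h.1 hv, termSyms_subst_subset h.2 hv⟩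
  | rel R ts =>
    simp only [boundedSyms, ofFO, syms, Set.insert_subset_iff, Set.iUnion_subset_iff] at h ⊢
    exact ⟨h.1, fun i => termSyms_subst_subset (h.2 i) hv⟩
  | imp φ ψ ihφ ihψ =>
    simp only [boundedSyms, ofFO, syms_imp, Set.union_subset_iff] at h ⊢
    exact ⟨ihφ h.1, ihψ h.2⟩
  | all φ ih => exact ih h

/-- The atomic formulas over the symbols in `U`. -/
def atomSet (U : Set (Symb L)) : Set (Fml Θ) :=
  Set.image2 eq {t | termSyms t ⊆ U} {t | termSyms t ⊆ U} ∪
  (⋃ R ∈ {R : Σ k, L.Relations k | Sum.inr R ∈ U},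
    rel R.2 '' {ts | ∀ i, ts i ∈ {t | termSyms t ⊆ U}}) ∪
  (⋃ l, ⋃ m, Set.range (soEq l m)) ∪
  (⋃ l : Ar Θ, ⋃ m, soApp l m '' {ts | ∀ i, ts i ∈ {t | termSyms t ⊆ U}})

/-- The formulas over the symbols in `U` of depth below `n`. -/
def stage (U : Set (Symb L)) : ℕ → Set (Fml Θ)
  | 0 => atomSet U
  | n + 1 => stage U n ∪ neg '' stage U n ∪ Set.image2 and (stage U n) (stage U n) ∪
      (⋃ x, all x '' stage U n) ∪ ⋃ l, ⋃ m, soAll l m '' stage U n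

theorem countable_stage {U : Set (Symb L)} (hU : U.Countable) (n : ℕ) :
    (stage U n : Set (Fml Θ)).Countable := by
  have ht := countable_terms hU
  induction n with
  | zero =>
    refine (((ht.image2 ht _).union ?_).union ?_).union ?_
    · exact (hU.preimage Sum.inr_injective).biUnion fun R _ => (countable_pi_fin ht _).image _
    · exact Set.countable_iUnion fun _ => Set.countable_iUnion fun _ => Set.countable_range _
    · exact Set.countable_iUnion fun _ => Set.countable_iUnion fun _ =>
        (countable_pi_fin ht _).image _
  | succ n ih =>
    refine (((ih.union (ih.image _)).union (ih.image2 ih _)).union ?_).union ?_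
    · exact Set.countable_iUnion fun _ => ih.image _
    · exact Set.countable_iUnion fun _ => Set.countable_iUnion fun _ => ih.image _

theorem stage_mono (U : Set (Symb L)) : Monotone (stage U : ℕ → Set (Fml Θ)) :=
  monotone_nat_of_le_succ fun _ _ h => Or.inl (Or.inl (Or.inl (Or.inl h)))

theorem exists_mem_stage {U : Set (Symb L)} {φ : Fml Θ} (h : syms φ ⊆ U) : ∃ n, φ ∈ stage U n := by
  induction φ with
  | eq s t =>
    rw [syms, Set.union_subset_iff] at h
    exact ⟨0, Or.inl (Or.inl (Or.inl ⟨s, h.1, t, h.2, rfl⟩))⟩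
  | rel R ts =>
    simp only [syms, Set.insert_subset_iff, Set.iUnion_subset_iff] at h
    refine ⟨0, Or.inl (Or.inl (Or.inr ?_))⟩
    simp only [Set.mem_iUnion]
    exact ⟨⟨_, R⟩, h.1, ts, h.2, rfl⟩
  | soEq l m n =>
    refine ⟨0, Or.inl (Or.inr ?_)⟩
    simp only [Set.mem_iUnion]
    exact ⟨l, m, n, rfl⟩
  | soApp l m ts =>
    simp only [syms, Set.iUnion_subset_iff] at h
    refine ⟨0, Or.inr ?_⟩
    simp only [Set.mem_iUnion]
    exact ⟨l, m, ts, h, rfl⟩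
  | neg φ ih =>
    obtain ⟨n, hn⟩ := ih h
    exact ⟨n + 1, Or.inl (Or.inl (Or.inl (Or.inr ⟨φ, hn, rfl⟩)))⟩
  | and φ ψ ihφ ihψ =>
    rw [syms, Set.union_subset_iff] at h
    obtain ⟨m, hm⟩ := ihφ h.1
    obtain ⟨n, hn⟩ := ihψ h.2
    exact ⟨max m n + 1, Or.inl (Or.inl (Or.inr ⟨φ, stage_mono U (le_max_left _ _) hm,
      ψ, stage_mono U (le_max_right _ _) hn, rfl⟩))⟩
  | all x φ ih =>
    obtain ⟨n, hn⟩ := ih h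
    exact ⟨n + 1, Or.inl (Or.inr (Set.mem_iUnion.2 ⟨x, φ, hn, rfl⟩))⟩
  | soAll l m φ ih =>
    obtain ⟨n, hn⟩ := ih h
    refine ⟨n + 1, Or.inr ?_⟩
    simp only [Set.mem_iUnion]
    exact ⟨l, m, φ, hn, rfl⟩

theorem countable_formulas {U : Set (Symb L)} (hU : U.Countable) :
    {φ : Fml Θ | syms φ ⊆ U}.Countable :=
  (Set.countable_iUnion fun n => countable_stage hU n).mono fun _ h =>
    Set.mem_iUnion.2 (exists_mem_stage h)

/-! ### Henkin theories obtained by forcing with consistent formulas -/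

/-- `∀ x̄ (V_m(x̄) ↔ V_n(x̄))`. -/
def coext (l : Ar Θ) (m n : ℕ) : Fml Θ :=
  allBlock 0 (l.1 + 1) (iff (soApp l m fun i => Term.var i.1) (soApp l n fun i => Term.var i.1))

theorem Proves.coext_self {Sig : Set (Fml Θ)} (l : Ar Θ) (m : ℕ) : Proves Sig (coext l m m) :=
  (Proves.taut fun val hv => by simp only [hv.iff]).allBlock _ _

/-- Complete theories that contain the theorems of `Sig`; complete relative to the
formulas over the symbols in `U`, with witnesses of arbitrarily large index for both sorts of
quantifiers, and in which each `V_n` is definable by a member of `Θ`. -/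
structure IsHenkin (Sig : Set (Fml Θ)) (U : Set (Symb L)) (T : Set (Fml Θ)) : Prop
    extends IsTheory T where
  proves : ∀ {φ}, Proves Sig φ → φ ∈ T
  consistent : ∀ {φ}, φ ∈ T → neg φ ∉ T
  complete : ∀ {φ}, syms φ ⊆ U → φ ∈ T ∨ neg φ ∈ T
  witness : ∀ {φ}, syms φ ⊆ U → ∀ x N, all x φ ∈ T ∨ ∃ y ≥ N, neg (subst x (Term.var y) φ) ∈ T
  soWitness : ∀ {φ}, syms φ ⊆ U → ∀ l m N, soAll l m φ ∈ T ∨ ∃ n ≥ N, neg (soSubst l m n φ) ∈ T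
  definable : ∀ (l : Ar Θ) (n : ℕ), ∃ θ ∈ Θ l.1,
    neg (schemeInst l (n + 1) θ (neg (coext l n (n + 1)))) ∈ T

/-- The formulas that are consistent with `Sig`. -/
def Condition (Sig : Set (Fml Θ)) := {χ : Fml Θ // ¬ Proves Sig (neg χ)}

/-- The formulas that follow from a condition. -/
def Condition.consequences {Sig : Set (Fml Θ)} (χ : Condition Sig) : Set (Fml Θ) :=
  {ψ | Proves Sig (imp χ.1 ψ)}

namespace Condition

variable {Sig : Set (Fml Θ)}

/-- Stronger conditions are larger: χ ≤ χ' means that `Sig` proves χ' → χ. A generic family of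
conditions is thus an order ideal. -/
instance : Preorder (Condition Sig) where
  le χ χ' := χ.1 ∈ χ'.consequences
  le_refl _ := Proves.taut fun val hv => (hv.imp _ _).2 id
  le_trans _ _ _ h h' := Proves.imp_trans h' h

theorem consequences_mono {χ χ' : Condition Sig} (h : χ ≤ χ') :
    χ.consequences ⊆ χ'.consequences :=
  fun _ hψ => Proves.imp_trans h hψ

theorem consistent (χ : Condition Sig) {ψ : Fml Θ} (h : ψ ∈ χ.consequences) :
    neg ψ ∉ χ.consequences := fun h' =>
  χ.2 (.of_two (fun val hv => by simp only [hv.imp, hv.neg]; tauto) h h')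

/-- The stronger condition is χ ∧ ¬ψ. A refutation of it would prove χ → ψ. -/
theorem exists_le_of_notMem (χ : Condition Sig) {ψ : Fml Θ} (h : ψ ∉ χ.consequences) :
    ∃ χ', χ ≤ χ' ∧ neg ψ ∈ χ'.consequences := by
  refine ⟨⟨and χ.1 (neg ψ), fun h' => h ?_⟩, ?_, ?_⟩
  · exact Proves.of_one (fun val hv => by simp only [hv.neg, hv.and, hv.imp]; tauto) h'
  · exact Proves.taut fun val hv => by simp only [hv.and, hv.imp]; tauto
  · exact Proves.taut fun val hv => by simp only [hv.and, hv.imp]; tauto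

theorem exists_complete (χ : Condition Sig) (ψ : Fml Θ) :
    ∃ χ', χ ≤ χ' ∧ (ψ ∈ χ'.consequences ∨ neg ψ ∈ χ'.consequences) := by
  by_cases h : ψ ∈ χ.consequences
  · exact ⟨χ, le_rfl, Or.inl h⟩
  · obtain ⟨χ', h1, h2⟩ := χ.exists_le_of_notMem h
    exact ⟨χ', h1, Or.inr h2⟩

theorem exists_witness (χ : Condition Sig) (ψ : Fml Θ) (x N : ℕ) :
    ∃ χ', χ ≤ χ' ∧ (all x ψ ∈ χ'.consequences ∨
      ∃ y ≥ N, neg (subst x (Term.var y) ψ) ∈ χ'.consequences) := by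
  by_cases h : all x ψ ∈ χ.consequences
  · exact ⟨χ, le_rfl, Or.inl h⟩
  -- The index of the witness exceeds N and every variable of χ and ∀x ψ. If this instance followed
  -- from χ, so would ∀x ψ.
  · obtain ⟨χ', h1, h2⟩ := χ.exists_le_of_notMem
      (ψ := subst x (Term.var (max N (max (varBound χ.1) (varBound (all x ψ))))) ψ)
      fun h' => h (Proves.imp_all_of_fresh (by omega) (by omega) h')
    exact ⟨χ', h1, Or.inr ⟨_, le_max_left _ _, h2⟩⟩

theorem exists_soWitness (χ : Condition Sig) (ψ : Fml Θ) (l : Ar Θ) (m N : ℕ) :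
    ∃ χ', χ ≤ χ' ∧ (soAll l m ψ ∈ χ'.consequences ∨
      ∃ n ≥ N, neg (soSubst l m n ψ) ∈ χ'.consequences) := by
  by_cases h : soAll l m ψ ∈ χ.consequences
  · exact ⟨χ, le_rfl, Or.inl h⟩
  · obtain ⟨χ', h1, h2⟩ := χ.exists_le_of_notMem
      (ψ := soSubst l m (max N (max (soBound χ.1) (soBound (soAll l m ψ)))) ψ)
      fun h' => h (Proves.imp_soAll_of_fresh (by omega) (by omega) h')
    exact ⟨χ', h1, Or.inr ⟨_, le_max_left _ _, h2⟩⟩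

/-- This is the omitting-types step. If no stronger condition made V_n definable, χ would imply
every premise of the infinitary rule, and hence that no V is coextensive with V_n. -/
theorem exists_definable (hΘ : ∀ l, (Θ l).Countable) (χ : Condition Sig) (l : Ar Θ) (n : ℕ) :
    ∃ χ', χ ≤ χ' ∧ ∃ θ ∈ Θ l.1,
      neg (schemeInst l (n + 1) θ (neg (coext l n (n + 1)))) ∈ χ'.consequences := by
  by_contra! hcon
  have h : Proves Sig (imp χ.1 (soAll l (n + 1) (neg (coext l n (n + 1))))) := by
    refine Proves.soAll_of_schemeInst (hΘ l.1) fun θ hθ => ?_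
    by_contra h'
    obtain ⟨χ', h1, h2⟩ := χ.exists_le_of_notMem h'
    exact hcon χ' h1 θ hθ h2
  -- Instantiating the quantified variable by V_n turns the conclusion into the negation of ∀x̄
  -- (V_n(x̄) ↔ V_n(x̄)).
  have hfree : SOFreeFor l (n + 1) n (neg (coext l n (n + 1))) :=
    soFreeFor_allBlock ⟨⟨trivial, trivial⟩, trivial, trivial⟩
  have h' := h.imp_trans (.ax (.soAllElim l (n + 1) n _ hfree))
  have hs : soSubst l (n + 1) n (neg (coext l n (n + 1))) = neg (coext l n n) := by
    simp [coext, soSubst, soSubst_allBlock, iff, imp]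
  rw [hs] at h'
  exact χ.2 (.of_two (fun val hv => by simp only [hv.imp, hv.neg]; tauto) h' (.coext_self l n))

end Condition

/-- The countably many requirements on a Henkin theory. -/
def Requirement (U : Set (Symb L)) (S : Set (Fml Θ)) :
    ({φ : Fml Θ // syms φ ⊆ U} ⊕ ({φ : Fml Θ // syms φ ⊆ U} × ℕ × ℕ) ⊕
      ({φ : Fml Θ // syms φ ⊆ U} × Ar Θ × ℕ × ℕ) ⊕ (Ar Θ × ℕ)) → Prop
  | .inl φ => φ.1 ∈ S ∨ neg φ.1 ∈ S
  | .inr (.inl ⟨φ, x, N⟩) => all x φ.1 ∈ S ∨ ∃ y ≥ N, neg (subst x (Term.var y) φ.1) ∈ S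
  | .inr (.inr (.inl ⟨φ, l, m, N⟩)) => soAll l m φ.1 ∈ S ∨ ∃ n ≥ N, neg (soSubst l m n φ.1) ∈ S
  | .inr (.inr (.inr ⟨l, n⟩)) => ∃ θ ∈ Θ l.1,
      neg (schemeInst l (n + 1) θ (neg (coext l n (n + 1)))) ∈ S

theorem Requirement.mono {U : Set (Symb L)} {S S' : Set (Fml Θ)} (h : S ⊆ S') :
    ∀ {i}, Requirement U S i → Requirement U S' i
  | .inl _, h' => h'.imp (@h _) (@h _)
  | .inr (.inl _), h' => h'.imp (@h _) fun ⟨y, hy, h'⟩ => ⟨y, hy, h h'⟩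
  | .inr (.inr (.inl _)), h' => h'.imp (@h _) fun ⟨y, hy, h'⟩ => ⟨y, hy, h h'⟩
  | .inr (.inr (.inr _)), ⟨θ, hθ, h'⟩ => ⟨θ, hθ, h h'⟩

theorem Condition.exists_requirement {Sig : Set (Fml Θ)} (hΘ : ∀ l, (Θ l).Countable)
    (U : Set (Symb L)) (χ : Condition Sig) : ∀ i, ∃ χ', χ ≤ χ' ∧ Requirement U χ'.consequences i
  | .inl φ => χ.exists_complete φ.1
  | .inr (.inl ⟨φ, x, N⟩) => χ.exists_witness φ.1 x N
  | .inr (.inr (.inl ⟨φ, l, m, N⟩)) => χ.exists_soWitness φ.1 l m N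
  | .inr (.inr (.inr ⟨l, n⟩)) => χ.exists_definable hΘ l n

theorem exists_isHenkin {Sig : Set (Fml Θ)} (hΘ : ∀ l, (Θ l).Countable) {U : Set (Symb L)}
    (hU : U.Countable) {φ : Fml Θ} (hφ : ¬ Proves Sig (neg φ)) :
    ∃ T, IsHenkin Sig U T ∧ φ ∈ T := by
  have : Countable {φ : Fml Θ // syms φ ⊆ U} := (countable_formulas hU).to_subtype
  have := Encodable.ofCountable ({φ : Fml Θ // syms φ ⊆ U} ⊕ ({φ : Fml Θ // syms φ ⊆ U} × ℕ × ℕ) ⊕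
      ({φ : Fml Θ // syms φ ⊆ U} × Ar Θ × ℕ × ℕ) ⊕ (Ar Θ × ℕ))
  -- Each requirement is met cofinally, and there are countably many of them, so the
  -- Rasiowa–Sikorski lemma gives an ideal that meets all. T collects the consequences of its
  -- members.
  let D : _ → Order.Cofinal (Condition Sig) := fun i =>
    { carrier := {χ | Requirement U χ.consequences i}
      isCofinal := fun χ => by
        obtain ⟨χ', h, h'⟩ := χ.exists_requirement hΘ U i
        exact ⟨χ', h', h⟩ }
  let p : Condition Sig := ⟨φ, hφ⟩
  let I := Order.idealOfCofinals p D
  let T : Set (Fml Θ) := {ψ | ∃ χ ∈ I, ψ ∈ χ.consequences}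
  have hsub : ∀ χ ∈ I, χ.consequences ⊆ T := fun χ hχ ψ hψ => ⟨χ, hχ, hψ⟩
  have hp : p ∈ I := Order.mem_idealOfCofinals p D
  have hdir : ∀ {ψ ψ'}, ψ ∈ T → ψ' ∈ T → ∃ χ ∈ I, ψ ∈ χ.consequences ∧ ψ' ∈ χ.consequences := by
    rintro ψ ψ' ⟨χ, hχ, h⟩ ⟨χ', hχ', h'⟩
    obtain ⟨χ'', hχ'', h1, h2⟩ := I.directed _ hχ _ hχ'
    exact ⟨χ'', hχ'', Condition.consequences_mono h1 h, Condition.consequences_mono h2 h'⟩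
  have hreq : ∀ i, Requirement U T i := fun i => by
    obtain ⟨χ, hχ, hχI⟩ := Order.cofinal_meets_idealOfCofinals p D i
    exact Requirement.mono (hsub χ hχI) hχ
  have hprov : ∀ ψ, Proves Sig ψ → ψ ∈ T := fun ψ hψ =>
    ⟨p, hp, Proves.of_one (fun val hv => by simp only [hv.imp]; tauto) hψ⟩
  refine ⟨T, ⟨⟨fun h => hprov _ (.taut h), fun h h' => ?_⟩, hprov _, fun h h' => ?_,
    fun {φ} h => ?_, fun {φ} h x N => ?_, fun {φ} h l m N => ?_, fun l n => ?_⟩, ⟨p, hp, ?_⟩⟩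
  · obtain ⟨χ, hχ, h1, h2⟩ := hdir h h'
    exact ⟨χ, hχ, Proves.of_two (fun val hv => by simp only [hv.imp]; tauto) h1 h2⟩
  · obtain ⟨χ, -, h1, h2⟩ := hdir h h'
    exact χ.consistent h1 h2
  · exact hreq (.inl ⟨φ, h⟩)
  · exact hreq (.inr (.inl ⟨⟨φ, h⟩, x, N⟩))
  · exact hreq (.inr (.inr (.inl ⟨⟨φ, h⟩, l, m, N⟩)))
  · exact hreq (.inr (.inr (.inr ⟨l, n⟩)))
  · exact Proves.taut fun val hv => (hv.imp _ _).2 id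

/-! ### Satisfaction under substitution and blocks of quantifiers -/

section Semantics

variable {A : Type w} [L.Structure A]

theorem sat_imp {a : ℕ → A} {S : (l : Ar Θ) → ℕ → Set (Fin (l.1 + 1) → A)} {φ ψ : Fml Θ} :
    Sat a S (imp φ ψ) ↔ (Sat a S φ → Sat a S ψ) := by
  simp only [imp, Sat]
  tauto

theorem sat_iff {a : ℕ → A} {S : (l : Ar Θ) → ℕ → Set (Fin (l.1 + 1) → A)} {φ ψ : Fml Θ} :
    Sat a S (iff φ ψ) ↔ (Sat a S φ ↔ Sat a S ψ) := by
  simp only [iff, sat_imp, Sat]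
  tauto

theorem sat_congr {φ : Fml Θ} {a b : ℕ → A} {S S' : (l : Ar Θ) → ℕ → Set (Fin (l.1 + 1) → A)}
    (h : ∀ x, FreeIn x φ → a x = b x) (hS : ∀ l m, SOFreeIn l m φ → S l m = S' l m) :
    Sat a S φ ↔ Sat b S' φ := by
  induction φ generalizing a b S S' with
  | eq s t =>
    simp only [Sat]
    rw [term_realize_congr fun x hx => h x (Or.inl hx),
      term_realize_congr fun x hx => h x (Or.inr hx)]
  | rel R ts =>
    simp only [Sat]
    have : ∀ i, (ts i).realize a = (ts i).realize b :=
      fun i => term_realize_congr fun x hx => h x ⟨i, hx⟩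
    simp only [this]
  | soEq l m n =>
    simp only [Sat]
    rw [hS l m ⟨rfl, Or.inl rfl⟩, hS l n ⟨rfl, Or.inr rfl⟩]
  | soApp l m ts =>
    simp only [Sat]
    have : ∀ i, (ts i).realize a = (ts i).realize b :=
      fun i => term_realize_congr fun x hx => h x ⟨i, hx⟩
    simp only [this, hS l m ⟨rfl, rfl⟩]
  | neg φ ih => exact not_congr (ih h hS)
  | and φ ψ ihφ ihψ =>
    exact and_congr (ihφ (fun x hx => h x (Or.inl hx)) fun l m hm => hS l m (Or.inl hm))
      (ihψ (fun x hx => h x (Or.inr hx)) fun l m hm => hS l m (Or.inr hm))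
  | all x φ ih =>
    refine forall_congr' fun c => ih (fun y hy => ?_) hS
    rcases eq_or_ne y x with rfl | hyx
    · simp
    · simp only [Function.update_of_ne hyx]
      exact h y ⟨hyx, hy⟩
  | soAll l m φ ih =>
    refine forall₂_congr fun B _ => ih h fun l' i hi => ?_
    rcases eq_or_ne l' l with rfl | hl
    · rcases eq_or_ne i m with rfl | him
      · simp
      · simp only [Function.update_self, Function.update_of_ne him]
        exact hS _ _ ⟨fun h' => him h'.2.symm, hi⟩
    · simp only [Function.update_of_ne hl]
      exact hS _ _ ⟨fun h' => hl h'.1.symm, hi⟩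

theorem sat_subst {φ : Fml Θ} {x y : ℕ} (h : varBound φ ≤ y) {a : ℕ → A}
    {S : (l : Ar Θ) → ℕ → Set (Fin (l.1 + 1) → A)} :
    Sat a S (subst x (Term.var y) φ) ↔ Sat (Function.update a x (a y)) S φ := by
  induction φ generalizing a S with
  | eq | rel | soApp => simp only [Sat, subst, term_realize_subst, Term.realize_var]
  | soEq l m n => rfl
  | neg φ ih => exact not_congr (ih h)
  | and φ ψ ihφ ihψ =>
    simp only [varBound, max_le_iff] at h
    exact and_congr (ihφ h.1) (ihψ h.2)
  | all z φ ih =>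
    simp only [varBound, max_le_iff] at h
    by_cases hz : z = x
    · subst hz
      simp only [subst, if_true, Sat, Function.update_idem]
    · simp only [subst, if_neg hz, Sat]
      refine forall_congr' fun c => ?_
      rw [ih h.2, Function.update_comm hz, Function.update_of_ne (by omega : y ≠ z)]
  | soAll l m φ ih => exact forall₂_congr fun B _ => ih h

theorem sat_soSubst {φ : Fml Θ} {l : Ar Θ} {m n : ℕ} (h : soBound φ ≤ n) {a : ℕ → A}
    {S : (l : Ar Θ) → ℕ → Set (Fin (l.1 + 1) → A)} :
    Sat a S (soSubst l m n φ) ↔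
      Sat a (Function.update S l (Function.update (S l) m (S l n))) φ := by
  have hv : ∀ (S : (l : Ar Θ) → ℕ → Set (Fin (l.1 + 1) → A)) i,
      S l (if i = m then n else i) = Function.update (S l) m (S l n) i := fun S i => by
    split_ifs with hi
    · simp [hi]
    · simp [hi]
  induction φ generalizing a S with
  | eq | rel => rfl
  | soEq l' i j =>
    by_cases hl : l' = l
    · subst hl
      simp only [soSubst, if_true, Sat, Function.update_self, hv]
    · simp only [soSubst, if_neg hl, Sat, Function.update_of_ne hl]
  | soApp l' i ts =>
    by_cases hl : l' = l
    · subst hl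
      simp only [soSubst, true_and, Sat, Function.update_self, hv]
    · simp only [soSubst, hl, false_and, if_false, Sat, Function.update_of_ne hl]
  | neg φ ih => exact not_congr (ih h)
  | and φ ψ ihφ ihψ =>
    simp only [soBound, max_le_iff] at h
    exact and_congr (ihφ h.1) (ihψ h.2)
  | all z φ ih => exact forall_congr' fun c => ih h
  | soAll l' i φ ih =>
    simp only [soBound, max_le_iff] at h
    by_cases hi : l' = l ∧ i = m
    · obtain ⟨rfl, rfl⟩ := hi
      simp only [soSubst, and_self, if_true, Sat, Function.update_self, Function.update_idem]
    · simp only [soSubst, if_neg hi, Sat]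
      refine forall₂_congr fun B _ => ?_
      refine (ih h.2).trans (iff_of_eq ?_)
      by_cases hl : l' = l
      · subst hl
        have him : i ≠ m := fun h' => hi ⟨rfl, h'⟩
        simp only [Function.update_self, Function.update_idem]
        rw [Function.update_comm him, Function.update_of_ne (by omega : n ≠ i)]
      · rw [Function.update_comm hl, Function.update_of_ne (Ne.symm hl), Function.update_of_ne hl]

/-- The assignment `a` with the values at `s, …, s + n - 1` replaced by those of `b`. -/
def blockUpdate (a : ℕ → A) (s n : ℕ) (b : ℕ → A) : ℕ → A :=
  fun x => if s ≤ x ∧ x < s + n then b x else a x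

theorem blockUpdate_zero (a : ℕ → A) (s : ℕ) (b : ℕ → A) : blockUpdate a s 0 b = a := by
  funext x
  exact if_neg (by omega)

theorem blockUpdate_succ (a : ℕ → A) (s n : ℕ) (b : ℕ → A) :
    blockUpdate a s (n + 1) b = blockUpdate (Function.update a s (b s)) (s + 1) n b := by
  funext x
  unfold blockUpdate
  rcases eq_or_ne x s with rfl | hx
  · rw [if_pos (by omega), if_neg (by omega), Function.update_self]
  · rw [Function.update_of_ne hx]
    exact if_congr (by omega) rfl rfl

theorem blockUpdate_succ' (a : ℕ → A) (s n : ℕ) (b : ℕ → A) :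
    blockUpdate a s (n + 1) b = Function.update (blockUpdate a (s + 1) n b) s (b s) := by
  funext x
  rcases eq_or_ne x s with rfl | hx
  · rw [Function.update_self]
    exact if_pos (by omega)
  · rw [Function.update_of_ne hx]
    exact if_congr (by omega) rfl rfl

theorem sat_allBlock {φ : Fml Θ} {s n : ℕ} {a : ℕ → A}
    {S : (l : Ar Θ) → ℕ → Set (Fin (l.1 + 1) → A)} :
    Sat a S (allBlock s n φ) ↔ ∀ b, Sat (blockUpdate a s n b) S φ := by
  induction n generalizing s a with
  | zero =>
    simp only [allBlock, blockUpdate_zero]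
    exact ⟨fun h _ => h, fun h => h a⟩
  | succ n ih =>
    simp only [allBlock, Sat, ih, blockUpdate_succ]
    refine ⟨fun h b => h _ _, fun h c b => ?_⟩
    -- The remaining block starts at s + 1 and does not read b at s, so b may be given the value c
    -- there.
    have := h (Function.update b s c)
    rw [Function.update_self] at this
    convert this using 1
    funext x
    unfold blockUpdate
    refine ite_congr rfl (fun hx => ?_) fun _ => rfl
    rw [Function.update_of_ne (by omega)]

theorem sat_allBlock_zero {φ : Fml Θ} {n : ℕ} {a : ℕ → A}
    {S : (l : Ar Θ) → ℕ → Set (Fin (l.1 + 1) → A)} :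
    Sat a S (allBlock 0 n φ) ↔
      ∀ d : Fin n → A, Sat (fun x => if h : x < n then d ⟨x, h⟩ else a x) S φ := by
  rw [sat_allBlock]
  constructor
  · intro h d
    convert h (fun x => if h : x < n then d ⟨x, h⟩ else a x) using 1
    funext x
    unfold blockUpdate
    by_cases hx : x < n
    · simp [hx]
    · simp [hx]
  · intro h b
    convert h (fun i => b i) using 1
    funext x
    unfold blockUpdate
    by_cases hx : x < n
    · simp [hx]
    · simp [hx]

/-- The bound variable with de Bruijn level i becomes x_{b+i}. All variables of the terms σ lie
below b, so their values survive the updates made by quantifiers. -/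
theorem sat_ofFO {α : Type} {b : ℕ} {σ : α → L.Term ℕ} {n : ℕ} {φ : L.BoundedFormula α n}
    (hσ : ∀ c, ∀ x ∈ (σ c).varFinset, x < b) {a : ℕ → A}
    {S : (l : Ar Θ) → ℕ → Set (Fin (l.1 + 1) → A)} :
    Sat a S (ofFO b σ φ) ↔ φ.Realize (fun c => (σ c).realize a) fun i => a (b + i.1) := by
  have hv : ∀ (a : ℕ → A) {n : ℕ} (t : L.Term (α ⊕ Fin n)),
      (t.subst (Sum.elim σ fun i => Term.var (b + i.1))).realize a =
        t.realize (Sum.elim (fun c => (σ c).realize a) fun i => a (b + i.1)) := fun a n t => by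
    rw [Term.realize_subst]
    congr 1
    funext c
    rcases c with c | i <;> rfl
  induction φ generalizing a with
  | falsum => simp [ofFO, bot, Sat, BoundedFormula.Realize]
  | equal s t => simp only [ofFO, Sat, hv, BoundedFormula.Realize]
  | rel R ts => simp only [ofFO, Sat, hv, BoundedFormula.Realize]
  | imp φ ψ ihφ ihψ => simp only [ofFO, sat_imp, ihφ, ihψ, BoundedFormula.Realize]
  | @all n φ ih =>
    simp only [ofFO, Sat, ih, BoundedFormula.Realize]
    refine forall_congr' fun c => ?_
    have h1 : (fun e => (σ e).realize (Function.update a (b + n) c)) =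
        fun e => (σ e).realize a := funext fun e => term_realize_congr fun x hx =>
      Function.update_of_ne (by have := hσ e x hx; omega) _ _
    have h2 : (fun i : Fin (n + 1) => Function.update a (b + n) c (b + i.1)) =
        Fin.snoc (fun i : Fin n => a (b + i.1)) c := by
      funext i
      refine Fin.lastCases ?_ (fun i => ?_) i
      · simp
      · rw [Fin.snoc_castSucc]
        exact Function.update_of_ne (by have := i.2; simp; omega) _ _
    rw [h1, h2]

theorem sat_ofScheme {l : ℕ} {θ : Scheme L l} {s b : ℕ} (hb : l + 1 ≤ b) (hs : s + θ.params ≤ b)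
    {a : ℕ → A} {S : (l : Ar Θ) → ℕ → Set (Fin (l.1 + 1) → A)} :
    Sat a S (ofScheme θ (fun i => Term.var i.1) s b) ↔
      θ.formula.Realize (Sum.elim (fun i => a i.1) fun j => a (s + j.1)) := by
  rw [ofScheme, sat_ofFO, Formula.Realize]
  · have : (fun c : Fin (l + 1) ⊕ Fin θ.params => Term.realize a (Sum.elim
        (fun i : Fin (l + 1) => (Term.var i.1 : L.Term ℕ)) (fun j => Term.var (s + j.1)) c)) =
        Sum.elim (fun i => a i.1) fun j => a (s + j.1) := by
      funext c
      rcases c with i | j <;> rfl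
    rw [this, Subsingleton.elim (fun i : Fin 0 => a (b + i.1)) default]
  · rintro (i | j) x hx
    · simp only [Sum.elim_inl, mem_varFinset_var] at hx
      omega
    · simp only [Sum.elim_inr, mem_varFinset_var] at hx
      omega

theorem sat_coext {l : Ar Θ} {m n : ℕ} {a : ℕ → A}
    {S : (l : Ar Θ) → ℕ → Set (Fin (l.1 + 1) → A)} :
    Sat a S (coext l m n) ↔ S l m = S l n := by
  simp only [coext, sat_allBlock_zero, sat_iff, Sat, Term.realize_var, Fin.is_lt, dite_true,
    Fin.eta, Set.ext_iff]

/-- `∀ x̄ (V_m(x̄) ↔ θ(x̄, ȳ))`, with `ȳ` the variables from `x_s` on and with bound variables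
of `θ` from `x_b` on. -/
def defines (l : Ar Θ) (m : ℕ) (θ : Scheme L l.1) (s b : ℕ) : Fml Θ :=
  allBlock 0 (l.1 + 1)
    (iff (soApp l m fun i => Term.var i.1) (ofScheme θ (fun i => Term.var i.1) s b))

theorem sat_defines {l : Ar Θ} {m : ℕ} {θ : Scheme L l.1} {s b : ℕ} (hs : l.1 + 1 ≤ s)
    (hb : s + θ.params ≤ b) {a : ℕ → A} {S : (l : Ar Θ) → ℕ → Set (Fin (l.1 + 1) → A)} :
    Sat a S (defines l m θ s b) ↔
      S l m = {d | θ.formula.Realize (Sum.elim d fun j => a (s + j.1))} := by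
  have h : ∀ j : Fin θ.params, ¬ s + j.1 < l.1 + 1 := fun j => by omega
  simp only [defines, sat_allBlock_zero, sat_iff, sat_ofScheme (hs.trans (by omega)) hb, Sat,
    Term.realize_var, Fin.is_lt, dite_true, Fin.eta, Set.ext_iff, h, dite_false, Set.mem_ofPred_eq]

end Semantics

/-! ### Henkin theories -/

namespace IsHenkin

variable {Sig : Set (Fml Θ)} {U : Set (Symb L)} {T : Set (Fml Θ)}

theorem mem_neg (hT : IsHenkin Sig U T) {φ : Fml Θ} (h : syms φ ⊆ U) : neg φ ∈ T ↔ φ ∉ T :=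
  ⟨fun h' h'' => hT.consistent h'' h', fun h' => (hT.complete h).resolve_left h'⟩

theorem mem_and (hT : IsHenkin Sig U T) {φ ψ : Fml Θ} : and φ ψ ∈ T ↔ φ ∈ T ∧ ψ ∈ T :=
  ⟨fun h => ⟨hT.of_one (fun _ hv h' => ((hv.and _ _).1 h').1) h,
    hT.of_one (fun _ hv h' => ((hv.and _ _).1 h').2) h⟩,
    fun h => hT.of_two (fun _ hv h1 h2 => (hv.and _ _).2 ⟨h1, h2⟩) h.1 h.2⟩

theorem of_neg_neg (hT : IsHenkin Sig U T) {φ : Fml Θ} (h : neg (neg φ) ∈ T) : φ ∈ T :=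
  hT.of_one (fun val hv => by simp only [hv.neg, not_not, imp_self]) h

theorem eq_refl (hT : IsHenkin Sig U T) (t : L.Term ℕ) : eq t t ∈ T :=
  hT.proves (.ax (.eqRefl t))

theorem subst_mem (hT : IsHenkin Sig U T) {φ : Fml Θ} {x : ℕ} {s t : L.Term ℕ}
    (hs : FreeFor x s φ) (ht : FreeFor x t φ) (h : eq s t ∈ T) (h' : subst x s φ ∈ T) :
    subst x t φ ∈ T :=
  hT.mp (hT.mp (hT.proves (.ax (.eqSubst x s t φ hs ht))) h) h'

theorem sup_notMem (t : L.Term ℕ) : t.varFinset.sup (· + 1) ∉ t.varFinset :=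
  fun h => absurd (lt_of_mem_varFinset h) (lt_irrefl _)

theorem eq_symm (hT : IsHenkin Sig U T) {s t : L.Term ℕ} (h : eq s t ∈ T) : eq t s ∈ T := by
  have := hT.subst_mem (φ := eq (Term.var (s.varFinset.sup (· + 1))) s)
    (x := s.varFinset.sup (· + 1)) trivial trivial h
  simp only [subst, term_subst_of_notMem (sup_notMem s), Term.subst, Function.update_self] at this
  exact this (hT.eq_refl s)

theorem eq_trans (hT : IsHenkin Sig U T) {s t r : L.Term ℕ} (h : eq s t ∈ T) (h' : eq t r ∈ T) :
    eq s r ∈ T := by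
  have := hT.subst_mem (φ := eq s (Term.var (s.varFinset.sup (· + 1))))
    (x := s.varFinset.sup (· + 1)) trivial trivial h'
  simp only [subst, term_subst_of_notMem (sup_notMem s), Term.subst, Function.update_self] at this
  exact this h

/-- Equal arguments may be exchanged in formulas `G(ts)` that are free of quantifiers. -/
theorem args_mem (hT : IsHenkin Sig U T) {n : ℕ} (G : (Fin n → L.Term ℕ) → Fml Θ) (b : ℕ)
    (hG : ∀ x ≥ b, ∀ r ts, FreeFor x r (G ts) ∧
      subst x r (G ts) = G fun i => (ts i).subst (Function.update Term.var x r))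
    {ts ts' : Fin n → L.Term ℕ} (h : ∀ i, eq (ts i) (ts' i) ∈ T) (h' : G ts ∈ T) : G ts' ∈ T := by
  have key : ∀ k ≤ n, G (fun i => if i.1 < k then ts' i else ts i) ∈ T := by
    intro k hk
    induction k with
    | zero => simpa using h'
    | succ k ih =>
      -- Arguments are exchanged one position at a time. At stage k the variable x, absent from all
      -- the terms, holds position k, and the equality axiom replaces `ts k` by `ts' k` there.
      let x := max b (max (Finset.univ.sup fun i => (ts i).varFinset.sup (· + 1))
        (Finset.univ.sup fun i => (ts' i).varFinset.sup (· + 1)))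
      have hx : ∀ i, x ∉ (ts i).varFinset ∧ x ∉ (ts' i).varFinset := fun i =>
        ⟨fun hi => absurd (lt_of_mem_varFinset_of_fin hi) (by omega),
          fun hi => absurd (lt_of_mem_varFinset_of_fin hi) (by omega)⟩
      let us : Fin n → L.Term ℕ := fun i =>
        if i.1 = k then Term.var x else if i.1 < k then ts' i else ts i
      have hus : ∀ r : L.Term ℕ, (fun i => (us i).subst (Function.update Term.var x r)) =
          fun i : Fin n => if i.1 = k then r else if i.1 < k then ts' i else ts i := by
        intro r
        funext i
        simp only [us]
        split_ifs
        · simp [Term.subst]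
        · exact term_subst_of_notMem (hx i).2
        · exact term_subst_of_notMem (hx i).1
      have hxb : x ≥ b := le_max_left _ _
      have hk' : k < n := hk
      have := hT.subst_mem (hG x hxb _ us).1 (hG x hxb _ us).1 (h ⟨k, hk'⟩)
      rw [(hG x hxb _ us).2, (hG x hxb _ us).2, hus, hus] at this
      convert this ?_ using 2
      · funext i
        rcases lt_trichotomy i.1 k with hi | hi | hi
        · rw [if_pos (by omega), if_neg (by omega), if_pos hi]
        · obtain rfl : i = ⟨k, hk'⟩ := Fin.ext hi
          simp
        · rw [if_neg (by omega), if_neg (by omega), if_neg (by omega)]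
      · convert ih (by omega) using 2
        funext i
        rcases eq_or_ne i.1 k with hi | hi
        · obtain rfl : i = ⟨k, hk'⟩ := Fin.ext hi
          simp
        · rw [if_neg hi]
  simpa using key n le_rfl

theorem args_mem_iff (hT : IsHenkin Sig U T) {n : ℕ} (G : (Fin n → L.Term ℕ) → Fml Θ) (b : ℕ)
    (hG : ∀ x ≥ b, ∀ r ts, FreeFor x r (G ts) ∧
      subst x r (G ts) = G fun i => (ts i).subst (Function.update Term.var x r))
    {ts ts' : Fin n → L.Term ℕ} (h : ∀ i, eq (ts i) (ts' i) ∈ T) : G ts ∈ T ↔ G ts' ∈ T :=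
  ⟨hT.args_mem G b hG h, hT.args_mem G b hG fun i => hT.eq_symm (h i)⟩

/-- Otherwise T would contain ∀x ¬ x = t, whose instance at t contradicts t = t. The arbitrarily
large index later makes it possible to avoid capture. -/
theorem exists_var (hT : IsHenkin Sig U T) {t : L.Term ℕ} (ht : termSyms t ⊆ U) (N : ℕ) :
    ∃ y ≥ N, eq t (Term.var y) ∈ T := by
  set x := t.varFinset.sup (· + 1) with hx
  have hs : ∀ r, subst x r (neg (eq (Term.var x) t) : Fml Θ) = neg (eq r t) := fun r => by
    simp only [subst, hx, term_subst_of_notMem (sup_notMem t), Term.subst, Function.update_self]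
  rcases hT.witness (φ := neg (eq (Term.var x) t)) (by simpa [syms, termSyms] using ht) x N with
    h | ⟨y, hy, h⟩
  · have := hT.mp (hT.proves (.ax (.allElim x t (neg (eq (Term.var x) t)) trivial))) h
    rw [hs] at this
    exact (hT.consistent (hT.eq_refl t) this).elim
  · rw [hs] at h
    exact ⟨y, hy, hT.eq_symm (hT.of_neg_neg h)⟩

theorem soAllElim_self (hT : IsHenkin Sig U T) {φ : Fml Θ} {l : Ar Θ} {m : ℕ}
    (h : soAll l m φ ∈ T) : φ ∈ T := by
  have := hT.mp (hT.proves (.ax (.soAllElim l m m φ soFreeFor_self))) h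
  rwa [soSubst_self] at this

theorem soEq_mem_iff (hT : IsHenkin Sig U T) {l : Ar Θ} {m n : ℕ} :
    soEq l m n ∈ T ↔ coext l m n ∈ T := by
  have h : iff (coext l m n) (soEq l m n) ∈ T :=
    hT.soAllElim_self (hT.soAllElim_self (hT.proves (.ax (.extensionality l m n))))
  exact ⟨hT.of_two (fun val hv => by simp only [hv.iff]; tauto) h,
    hT.of_two (fun val hv => by simp only [hv.iff]; tauto) h⟩

theorem exists_soVar (hT : IsHenkin Sig U T) (l : Ar Θ) (m N : ℕ) :
    ∃ n ≥ N, soEq l n m ∈ T := by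
  -- The index m + 1 only serves to provide a variable different from V_m to quantify over.
  have hs : ∀ r, soSubst l (m + 1) r (neg (soEq l (m + 1) m)) = neg (soEq l r m) := fun r => by
    simp [soSubst]
  rcases hT.soWitness (φ := neg (soEq l (m + 1) m)) (Set.empty_subset _) l (m + 1) N with
    h | ⟨n, hn, h⟩
  · have := hT.mp (hT.proves (.ax (.soAllElim l (m + 1) m (neg (soEq l (m + 1) m)) trivial))) h
    rw [hs] at this
    exact (hT.consistent (hT.soEq_mem_iff.2 (hT.proves (.coext_self l m))) this).elim
  · rw [hs] at h
    exact ⟨n, hn, hT.of_neg_neg h⟩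

end IsHenkin

/-! ### The term model -/

/-- The elements of the structure `A` are named by the variables, in accordance with the atomic
formulas that belong to `T`. -/
structure IsTermModel (T : Set (Fml Θ)) {A : Type w} [L.Structure A] (q : ℕ → A) : Prop where
  surjective : Function.Surjective q
  eq_iff : ∀ x y, q x = q y ↔ eq (Term.var x) (Term.var y) ∈ T
  relMap_iff : ∀ {n : ℕ} (R : L.Relations n) (x : Fin n → ℕ),
    Structure.RelMap R (fun i => q (x i)) ↔ rel R (fun i => Term.var (x i)) ∈ T
  funMap_eq : ∀ {n : ℕ} (f : L.Functions n) (x : Fin n → ℕ) (z : ℕ),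
    eq (Term.func f fun i => Term.var (x i)) (Term.var z) ∈ T →
      Structure.funMap f (fun i => q (x i)) = q z

theorem IsHenkin.exists_isTermModel {Sig : Set (Fml Θ)} {U : Set (Symb L)} {T : Set (Fml Θ)}
    (hT : IsHenkin Sig U T) :
    ∃ (A : Type w) (_ : L.Structure A) (q : ℕ → A), IsTermModel T q := by
  let r : Setoid ℕ := ⟨fun x y => eq (Term.var x) (Term.var y) ∈ T, fun x => hT.eq_refl _,
    fun h => hT.eq_symm h, fun h h' => hT.eq_trans h h'⟩
  let q : ℕ → ULift.{w} (Quotient r) := fun x => ⟨Quotient.mk r x⟩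
  have hq : Function.Surjective q := fun ⟨a⟩ => by
    obtain ⟨x, rfl⟩ := Quotient.exists_rep a
    exact ⟨x, rfl⟩
  have hqr : ∀ x y, q x = q y ↔ eq (Term.var x) (Term.var y) ∈ T := fun x y =>
    ULift.up_inj.trans Quotient.eq
  let rep := Function.surjInv hq
  have hrep : ∀ {n : ℕ} (x : Fin n → ℕ) i,
      eq (Term.var (x i)) (Term.var (rep (q (x i)))) ∈ T := fun x i =>
    (hqr _ _).1 (Function.surjInv_eq hq _).symm
  classical
  -- Symbols are interpreted on chosen representatives. For a function symbol outside U, T need not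
  -- equate its application with any variable, and the value `q 0` is then a dummy.
  let _ : L.Structure (ULift.{w} (Quotient r)) := ⟨fun f d =>
    if h : ∃ z, eq (Term.func f fun i => Term.var (rep (d i))) (Term.var z) ∈ T
      then q h.choose else q 0, fun R d => rel R (fun i => Term.var (rep (d i))) ∈ T⟩
  refine ⟨ULift.{w} (Quotient r), inferInstance, q, hq, hqr,
    fun {n} R x => ?_, fun {n} f x z hz => ?_⟩
  · exact (hT.args_mem_iff (rel R) 0 (fun _ _ _ _ => ⟨trivial, rfl⟩) (hrep x)).symm
  · have hz' := hT.args_mem (fun ts => eq (Term.func f ts) (Term.var z)) (z + 1)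
      (fun y hy r ts => ⟨trivial, by
        simp only [subst, Term.subst, Function.update_of_ne (by omega : z ≠ y)]⟩) (hrep x) hz
    have hex : ∃ z, eq (Term.func f fun i => Term.var (rep (q (x i)))) (Term.var z) ∈ T := ⟨z, hz'⟩
    refine (dif_pos hex).trans ((hqr _ _).2 ?_)
    exact hT.eq_trans (hT.eq_symm hex.choose_spec) hz'

/-- The relations named by the second-order variables in the term model. -/
def termRel (T : Set (Fml Θ)) {A : Type w} (q : ℕ → A) (l : Ar Θ) (m : ℕ) :
    Set (Fin (l.1 + 1) → A) :=
  {d | ∃ x : Fin (l.1 + 1) → ℕ, (d = fun i => q (x i)) ∧ soApp l m (fun i => Term.var (x i)) ∈ T}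

/-- No equations between relation variables and no second-order quantifiers. -/
def IsPlain : Fml Θ → Prop
  | eq _ _ => True
  | rel _ _ => True
  | soEq _ _ _ => False
  | soApp _ _ _ => True
  | neg φ => IsPlain φ
  | and φ ψ => IsPlain φ ∧ IsPlain ψ
  | all _ φ => IsPlain φ
  | soAll _ _ _ => False

theorem IsPlain.subst {φ : Fml Θ} {x : ℕ} {t : L.Term ℕ} (h : IsPlain φ) :
    IsPlain (subst x t φ) := by
  induction φ with
  | eq | rel | soApp => trivial
  | soEq | soAll => exact h.elim
  | neg φ ih => exact ih h
  | and φ ψ ihφ ihψ => exact ⟨ihφ h.1, ihψ h.2⟩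
  | all z φ ih =>
    rw [Fml.subst]
    split_ifs
    · exact h
    · exact ih h

theorem IsPlain.soSubst {φ : Fml Θ} {l : Ar Θ} {m n : ℕ} (h : IsPlain φ) :
    IsPlain (soSubst l m n φ) := by
  induction φ with
  | eq | rel | soApp => trivial
  | soEq | soAll => exact h.elim
  | neg φ ih | all z φ ih => exact ih h
  | and φ ψ ihφ ihψ => exact ⟨ihφ h.1, ihψ h.2⟩

theorem IsPlain.allBlock {φ : Fml Θ} (h : IsPlain φ) (s n : ℕ) : IsPlain (allBlock s n φ) := by
  induction n generalizing s with
  | zero => exact h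
  | succ n ih => exact ih _

theorem IsPlain.imp {φ ψ : Fml Θ} (hφ : IsPlain φ) (hψ : IsPlain ψ) : IsPlain (imp φ ψ) :=
  ⟨hφ, hψ⟩

theorem IsPlain.iff {φ ψ : Fml Θ} (hφ : IsPlain φ) (hψ : IsPlain ψ) : IsPlain (iff φ ψ) :=
  ⟨hφ.imp hψ, hψ.imp hφ⟩

theorem isPlain_coext (l : Ar Θ) (m n : ℕ) : IsPlain (coext l m n) :=
  IsPlain.allBlock (IsPlain.iff (φ := soApp ..) (ψ := soApp ..) trivial trivial) _ _

theorem isPlain_ofFO {α : Type} {b : ℕ} {σ : α → L.Term ℕ} {n : ℕ} {φ : L.BoundedFormula α n} :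
    IsPlain (ofFO b σ φ : Fml Θ) := by
  induction φ with
  | falsum | equal | rel => trivial
  | imp φ ψ ihφ ihψ => exact ihφ.imp ihψ
  | all φ ih => exact ih

theorem isPlain_defines (l : Ar Θ) (m : ℕ) (θ : Scheme L l.1) (s b : ℕ) :
    IsPlain (defines l m θ s b) :=
  IsPlain.allBlock (IsPlain.iff (φ := soApp ..) trivial isPlain_ofFO) _ _

theorem syms_coext (l : Ar Θ) (m n : ℕ) : syms (coext l m n) = ∅ := by
  simp [coext, syms_allBlock, syms_iff, syms, termSyms]

theorem syms_defines_subset {l : Ar Θ} {m : ℕ} {θ : Scheme L l.1} {s b : ℕ} {U : Set (Symb L)}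
    (h : boundedSyms θ.formula ⊆ U) : syms (defines l m θ s b) ⊆ U := by
  rw [defines, syms_allBlock, syms_iff, Set.union_subset_iff]
  refine ⟨by simp [syms, termSyms], syms_ofFO_subset h ?_⟩
  rintro (i | j) <;> exact Set.empty_subset _

/-! ### Truth lemma and standardness of the term model -/

namespace IsTermModel

variable {Sig : Set (Fml Θ)} {U : Set (Symb L)} {T : Set (Fml Θ)} {A : Type w} [L.Structure A]
  {q : ℕ → A}

/-- By induction each argument is equal in T to a variable that names its value. Exchanging these
arguments reduces the claim to the condition on function symbols applied to variables. -/
theorem realize_eq (hq : IsTermModel T q) (hT : IsHenkin Sig U T) {t : L.Term ℕ}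
    (ht : termSyms t ⊆ U) {z : ℕ} (h : eq t (Term.var z) ∈ T) : t.realize q = q z := by
  induction t generalizing z with
  | var x => exact (hq.eq_iff x z).2 h
  | func f ts ih =>
    simp only [termSyms, Set.insert_subset_iff, Set.iUnion_subset_iff] at ht
    choose y _ hy using fun i => hT.exists_var (ht.2 i) 0
    rw [Term.realize, funext fun i => ih i (ht.2 i) (hy i)]
    exact hq.funMap_eq f y z (hT.args_mem (fun ts => eq (Term.func f ts) (Term.var z)) (z + 1)
      (fun x hx r ts => ⟨trivial, by
        simp only [subst, Term.subst, Function.update_of_ne (by omega : z ≠ x)]⟩) hy h)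

theorem exists_ge (hq : IsTermModel T q) (hT : IsHenkin Sig U T) (a : A) (N : ℕ) :
    ∃ y ≥ N, q y = a := by
  obtain ⟨x, rfl⟩ := hq.surjective a
  obtain ⟨y, hy, h⟩ := hT.exists_var (t := Term.var x) (Set.empty_subset _) N
  exact ⟨y, hy, ((hq.eq_iff x y).2 h).symm⟩

theorem mem_termRel_iff (hq : IsTermModel T q) (hT : IsHenkin Sig U T) {l : Ar Θ} {m : ℕ}
    {x : Fin (l.1 + 1) → ℕ} :
    (fun i => q (x i)) ∈ termRel T q l m ↔ soApp l m (fun i => Term.var (x i)) ∈ T := by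
  refine ⟨fun ⟨y, hy, h⟩ => ?_, fun h => ⟨x, rfl, h⟩⟩
  exact hT.args_mem (soApp l m) 0 (fun _ _ _ _ => ⟨trivial, rfl⟩)
    (fun i => (hq.eq_iff _ _).1 (congrFun hy i).symm) h

/-- The truth lemma. It is first applied to plain formulas, with `Q` false; this is needed to show
that the term model is a standard structure. -/
theorem mem_iff_sat (hq : IsTermModel T q) (hT : IsHenkin Sig U T) (Q : Prop)
    (hEq : Q → ∀ l m n, soEq l m n ∈ T ↔ termRel T q l m = termRel T q l n)
    (hK : Q → ∀ (l : Ar Θ) B, B ∈ K Θ A l.1 ↔ ∃ n, termRel T q l n = B) {φ : Fml Θ}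
    (hφ : syms φ ⊆ U) (hQ : Q ∨ IsPlain φ) : φ ∈ T ↔ Sat q (termRel T q) φ := by
  induction hk : size φ using Nat.strong_induction_on generalizing φ with
  | _ k ih =>
  cases φ with
  | eq s t =>
    rw [syms, Set.union_subset_iff] at hφ
    obtain ⟨x, -, hx⟩ := hT.exists_var hφ.1 0
    obtain ⟨y, -, hy⟩ := hT.exists_var hφ.2 0
    rw [Sat, hq.realize_eq hT hφ.1 hx, hq.realize_eq hT hφ.2 hy, hq.eq_iff]
    exact ⟨fun h => hT.eq_trans (hT.eq_symm hx) (hT.eq_trans h hy),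
      fun h => hT.eq_trans hx (hT.eq_trans h (hT.eq_symm hy))⟩
  | rel R ts =>
    simp only [syms, Set.insert_subset_iff, Set.iUnion_subset_iff] at hφ
    choose y _ hy using fun i => hT.exists_var (hφ.2 i) 0
    rw [Sat, funext fun i => hq.realize_eq hT (hφ.2 i) (hy i), hq.relMap_iff]
    exact hT.args_mem_iff (rel R) 0 (fun _ _ _ _ => ⟨trivial, rfl⟩) hy
  | soEq l m n => exact hEq (hQ.resolve_right id) l m n
  | soApp l m ts =>
    simp only [syms, Set.iUnion_subset_iff] at hφ
    choose y _ hy using fun i => hT.exists_var (hφ i) 0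
    rw [Sat, funext fun i => hq.realize_eq hT (hφ i) (hy i), hq.mem_termRel_iff hT]
    exact hT.args_mem_iff (soApp l m) 0 (fun _ _ _ _ => ⟨trivial, rfl⟩) hy
  | neg φ =>
    rw [size] at hk
    replace hφ : syms φ ⊆ U := hφ
    rw [hT.mem_neg hφ, ih (size φ) (by omega) hφ hQ rfl, Sat]
  | and φ ψ =>
    rw [size] at hk
    rw [syms, Set.union_subset_iff] at hφ
    rw [hT.mem_and, ih (size φ) (by omega) hφ.1 (hQ.imp_right And.left) rfl,
      ih (size ψ) (by omega) hφ.2 (hQ.imp_right And.right) rfl, Sat]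
  | all x φ =>
    rw [size] at hk
    replace hφ : syms φ ⊆ U := hφ
    replace hQ : Q ∨ IsPlain φ := hQ
    have key : ∀ y ≥ varBound φ, (subst x (Term.var y) φ ∈ T ↔
        Sat (Function.update q x (q y)) (termRel T q) φ) := fun y hy => by
      rw [ih _ (by omega) (syms_subst_subset hφ) (hQ.imp_right IsPlain.subst) size_subst,
        sat_subst hy]
    constructor
    · intro h a
      obtain ⟨y, hy, rfl⟩ := hq.exists_ge hT a (varBound φ)
      exact (key y hy).1 (hT.mp (hT.proves (.ax (.allElim x _ φ (freeFor_of_varBound_le hy)))) h)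
    · intro h
      refine (hT.witness hφ x (varBound φ)).resolve_right ?_
      rintro ⟨y, hy, h'⟩
      exact hT.consistent ((key y hy).2 (h (q y))) h'
  | soAll l m φ =>
    rw [size] at hk
    replace hφ : syms φ ⊆ U := hφ
    have hQ' := hQ.resolve_right id
    have key : ∀ n ≥ soBound φ, (soSubst l m n φ ∈ T ↔ Sat q (Function.update (termRel T q) l
        (Function.update (termRel T q l) m (termRel T q l n))) φ) := fun n hn => by
      rw [ih _ (by omega) (by rwa [syms_soSubst]) (Or.inl hQ') size_soSubst, sat_soSubst hn]
    constructor
    · intro h B hB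
      obtain ⟨n, rfl⟩ := (hK hQ' l B).1 hB
      -- V_n may be captured in φ. It is replaced by a coextensive variable with an index beyond
      -- those in φ.
      obtain ⟨n', hn', h'⟩ := hT.exists_soVar l n (soBound φ)
      rw [← (hEq hQ' l n' n).1 h']
      exact (key n' hn').1
        (hT.mp (hT.proves (.ax (.soAllElim l m n' φ (soFreeFor_of_soBound_le hn')))) h)
    · intro h
      refine (hT.soWitness hφ l m (soBound φ)).resolve_right ?_
      rintro ⟨n, hn, h'⟩
      exact hT.consistent ((key n hn).2 (h _ ((hK hQ' l _).2 ⟨n, rfl⟩))) h'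

theorem mem_iff_sat_of_isPlain (hq : IsTermModel T q) (hT : IsHenkin Sig U T) {φ : Fml Θ}
    (hφ : syms φ ⊆ U) (h : IsPlain φ) : φ ∈ T ↔ Sat q (termRel T q) φ :=
  hq.mem_iff_sat hT False False.elim False.elim hφ (Or.inr h)

theorem soEq_mem_iff (hq : IsTermModel T q) (hT : IsHenkin Sig U T) (l : Ar Θ) (m n : ℕ) :
    soEq l m n ∈ T ↔ termRel T q l m = termRel T q l n := by
  rw [hT.soEq_mem_iff, hq.mem_iff_sat_of_isPlain hT _ (isPlain_coext l m n), sat_coext]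
  rw [syms_coext]
  exact Set.empty_subset _

/-- Only V_{n+1} is replaced, so the instance reads ∀ȳ ¬∀x̄ (V_n(x̄) ↔ θ(x̄, ȳ)). The block x̄
occupies indices up to `l`, which forces the parameters ȳ beyond it. -/
theorem schemeInst_coext (l : Ar Θ) (n : ℕ) (θ : Scheme L l.1) :
    ∃ N b, l.1 + 1 ≤ N ∧ N + θ.params ≤ b ∧
      schemeInst l (n + 1) θ (neg (coext l n (n + 1))) =
        Fml.allBlock N θ.params (neg (defines l n θ N b)) := by
  refine ⟨varBound (neg (coext l n (n + 1))),
    varBound (neg (coext l n (n + 1))) + θ.params + (l.1 + 1), ?_, by omega, ?_⟩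
  rotate_left
  · simp only [schemeInst, schemeSubst, coext, schemeSubst_allBlock, iff, imp, defines]
    simp [schemeAtom]
  · exact (by omega : l.1 + 1 ≤ 0 + (l.1 + 1)).trans (varBound_allBlock.2 (Nat.succ_pos _))

/-- The definability requirement asserts ∃ȳ ∀x̄ (V_n(x̄) ↔ θ(x̄, ȳ)). Its formula is plain, so it
holds in the term model, and the values of ȳ are the parameters sought. -/
theorem termRel_mem_K (hq : IsTermModel T q) (hT : IsHenkin Sig U T)
    (hU : ∀ l, ∀ θ ∈ Θ l, boundedSyms θ.formula ⊆ U) (l : Ar Θ) (n : ℕ) :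
    termRel T q l n ∈ K Θ A l.1 := by
  obtain ⟨θ, hθ, h⟩ := hT.definable l n
  obtain ⟨N, b, hN, hb, heq⟩ := schemeInst_coext l n θ
  rw [heq, hq.mem_iff_sat_of_isPlain hT
    (φ := neg (Fml.allBlock N θ.params (neg (defines l n θ N b))))
    (by rw [syms, syms_allBlock]; exact syms_defines_subset (hU _ θ hθ))
    (IsPlain.allBlock (φ := neg (defines l n θ N b)) (isPlain_defines ..) _ _), Sat,
    sat_allBlock, not_forall] at h
  obtain ⟨c, hc⟩ := h
  rw [Sat, not_not, sat_defines hN hb] at hc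
  exact ⟨θ, hθ, _, hc⟩

/-- Comprehension contains a second-order quantifier and so lies outside the plain truth lemma. The
universal block is instantiated in T by variables naming the given elements, then a second-order
witness is taken, and only the plain matrix is transferred to the model. -/
theorem exists_sat_of_soEx (hq : IsTermModel T q) (hT : IsHenkin Sig U T) {l : Ar Θ} {m s k : ℕ}
    {φ : Fml Θ} (hφ : syms φ ⊆ U) (hp : IsPlain φ) (h : Fml.allBlock s k (soEx l m φ) ∈ T)
    (b : ℕ → A) :
    ∃ n, Sat (blockUpdate q s k b) (Function.update (termRel T q) l
      (Function.update (termRel T q l) m (termRel T q l n))) φ := by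
  induction k generalizing s φ with
  | zero =>
    rcases hT.soWitness (φ := neg φ) hφ l m (soBound φ) with h' | ⟨n, hn, h'⟩
    · exact (hT.consistent h' h).elim
    · refine ⟨n, ?_⟩
      rw [blockUpdate_zero, ← sat_soSubst hn,
        ← hq.mem_iff_sat_of_isPlain hT (by rwa [syms_soSubst]) hp.soSubst]
      exact hT.of_neg_neg h'
  | succ k ih =>
    -- The name y lies beyond the whole block, so updating the remaining block leaves its value
    -- alone, and beyond all variables of the formula, so it is not captured.
    obtain ⟨y, hy, hyb⟩ := hq.exists_ge hT (b s)
      (max (s + k + 1) (varBound (Fml.allBlock (s + 1) k (soEx l m φ))))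
    have h' := hT.mp (hT.proves (.ax (.allElim s (Term.var y) _
      (freeFor_of_varBound_le (by omega))))) h
    rw [subst_allBlock (by omega)] at h'
    obtain ⟨n, hn⟩ := ih (φ := Fml.subst s (Term.var y) φ) (syms_subst_subset hφ) hp.subst h'
    have hφy : varBound φ ≤ y :=
      (varBound_allBlock (φ := soEx l m φ) (s := s + 1) (k := k)).1.trans (by omega)
    refine ⟨n, ?_⟩
    rw [sat_subst hφy] at hn
    have hby : blockUpdate q (s + 1) k b y = b s := (if_neg (by omega)).trans hyb
    rwa [hby, ← blockUpdate_succ'] at hn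

theorem exists_termRel_eq (hq : IsTermModel T q) (hT : IsHenkin Sig U T)
    (hU : ∀ l, ∀ θ ∈ Θ l, boundedSyms θ.formula ⊆ U) {l : Ar Θ} {B : Set (Fin (l.1 + 1) → A)}
    (hB : B ∈ K Θ A l.1) : ∃ n, termRel T q l n = B := by
  obtain ⟨θ, hθ, e, rfl⟩ := hB
  obtain ⟨n, hn⟩ := hq.exists_sat_of_soEx hT (φ := defines l 0 θ (l.1 + 1) (l.1 + 1 + θ.params))
    (syms_defines_subset (hU _ θ hθ)) (isPlain_defines ..)
    (hT.proves (.ax (.comprehension l 0 θ hθ)))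
    -- In the comprehension axiom the parameters are the variables from x_{l+1} on, and they receive
    -- the values `e`. Values outside that block do not matter.
    (fun x => if h : x - (l.1 + 1) < θ.params then e ⟨x - (l.1 + 1), h⟩ else q 0)
  rw [sat_defines le_rfl le_rfl] at hn
  refine ⟨n, ?_⟩
  simp only [Function.update_self] at hn
  rw [hn]
  congr! 4 with d
  funext j
  simp [blockUpdate]

end IsTermModel

/-! ### Completeness -/

theorem proves_of_entails (hΘ : ∀ l, (Θ l).Countable) {Sig : Set (Fml Θ)} (hSig : Sig.Countable)
    (hSent : ∀ σ ∈ Sig, IsSentence σ) {φ : Fml Θ} (h : Entails.{u, v, w} Sig φ) :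
    Proves Sig φ := by
  by_contra hcon
  let U : Set (Symb L) := (⋃ σ ∈ Sig, syms σ) ∪ syms φ ∪ ⋃ l, ⋃ θ ∈ Θ l, boundedSyms θ.formula
  have hUc : U.Countable := ((hSig.biUnion fun σ _ => countable_syms σ).union
    (countable_syms φ)).union (Set.countable_iUnion fun l =>
      (hΘ l).biUnion fun θ _ => countable_boundedSyms θ.formula)
  have hUS : ∀ σ ∈ Sig, syms σ ⊆ U := fun σ hσ s hs =>
    Or.inl (Or.inl (Set.mem_biUnion hσ hs))
  have hUφ : syms φ ⊆ U := fun s hs => Or.inl (Or.inr hs)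
  have hUΘ : ∀ l, ∀ θ ∈ Θ l, boundedSyms θ.formula ⊆ U := fun l θ hθ s hs =>
    Or.inr (Set.mem_iUnion.2 ⟨l, Set.mem_biUnion hθ hs⟩)
  obtain ⟨T, hT, hTφ⟩ := exists_isHenkin hΘ hUc (Sig := Sig) (φ := neg φ) fun h' => hcon
    (Proves.of_one (fun val hv => by simp only [hv.neg, not_not, imp_self]) h')
  obtain ⟨A, _, q, hq⟩ := hT.exists_isTermModel
  have : Nonempty A := ⟨q 0⟩
  have hK := hq.termRel_mem_K hT hUΘ
  have truth : ∀ {ψ : Fml Θ}, syms ψ ⊆ U → (ψ ∈ T ↔ Sat q (termRel T q) ψ) := fun hψ =>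
    hq.mem_iff_sat hT True (fun _ => hq.soEq_mem_iff hT) (fun _ l B =>
      ⟨hq.exists_termRel_eq hT hUΘ, fun ⟨n, hn⟩ => hn ▸ hK l n⟩) hψ (Or.inl trivial)
  refine (truth (ψ := neg φ) hUφ).1 hTφ (h A (fun σ hσ a S _ => ?_) q _ hK)
  -- T makes σ true only under the canonical assignment. Since σ is a sentence, it holds under every
  -- other assignment as well.
  exact (sat_congr (fun x hx => ((hSent σ hσ).1 x hx).elim)
    fun l m hm => ((hSent σ hσ).2 l m hm).elim).1 ((truth (hUS σ hσ)).1 (hT.proves (.premise hσ)))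

end Fml

end RestrictedSO

theorem mainTheorem1 {L : FirstOrder.Language.{u, v}} (Θ : RestrictedSO.Family L)
    (hΘ : ∀ l, (Θ l).Countable)
    (Sig : Set (RestrictedSO.Fml Θ)) (hSig : Sig.Countable)
    (hSent : ∀ σ ∈ Sig, RestrictedSO.Fml.IsSentence σ)
    (φ : RestrictedSO.Fml Θ) (hφ : RestrictedSO.Fml.IsSentence φ)
    (h : RestrictedSO.Fml.Entails.{u, v, w} Sig φ) :
    RestrictedSO.Fml.Proves Sig φ := 
  RestrictedSO.Fml.proves_of_entails hΘ hSig hSent h
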